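/- Let $\mathbb{K}\in\{\mathbb{R},\mathbb{C}\}$, let $m\ge 0$, let $S^1\times\mathbb{C}^m\to\mathbb{C}^m$, $(g,v)\mapsto gv$, be a smooth real-linear action of the circle group on $\mathbb{C}^m\cong\mathbb{R}^{2m}$ (for instance a unitary representation), and let $V\subset\mathbb{C}^m$ be open and $S^1$-invariant. For $k\ge 0$ let $\Omega^k_{\mathrm{rel}}(S^1\times V)$ be the space of $\mathbb{K}$-valued $k$-forms relative to the projection $S^1\times V\to S^1$, i.e. of smooth families $(g,v)\mapsto\omega_{(g,v)}$ of alternating $\mathbb{R}$-multilinear maps $\omega_{(g,v)}:(T_vV)^k\to\mathbb{K}$. Let $Y(g,v)=v-gv$, and let $i_Y:\Omega^{k+1}_{\mathrm{rel}}(S^1\times V)\to\Omega^{k}_{\mathrm{rel}}(S^1\times V)$ be contraction with $Y$; then $(\Omega^\bullet_{\mathrm{rel}}(S^1\times V),i_Y)$ is a chain complex, whose homology is denoted by $H_\bullet$. Let $\Lambda_0=\Lambda_0(S^1\ltimes V)=\{(g,v)\in S^1\times V : gv=v\}$ be the loop space, let $\mathcal{J}$ be the ideal of all smooth functions $S^1\times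 V\to\mathbb{K}$ that vanish on $\Lambda_0$, and let $d_{\mathrm{rel}}$ be the exterior differential along $V$. The space of relative $k$-forms on the loop space is $$\Omega^k_{\mathrm{rel}}(\Lambda_0)=\Omega^k_{\mathrm{rel}}(S^1\times V)\Big/\Big(\mathcal{J}\,\Omega^k_{\mathrm{rel}}(S^1\times V)+d_{\mathrm{rel}}\mathcal{J}\wedge\Omega^{k-1}_{\mathrm{rel}}(S^1\times V)\Big),$$ and $\mathfrak{R}:\Omega^k_{\mathrm{rel}}(S^1\times V)\to\Omega^k_{\mathrm{rel}}(\Lambda_0)$, $\omega\mapsto[\omega]$, is the restriction map. The space $\Omega^k_{\mathrm{hor}}(\Lambda_0)\subset\Omega^k_{\mathrm{rel}}(\Lambda_0)$ of horizontal relative $k$-forms consists of the classes that have a representative $\omega$ with $\omega_{(g,p)}\in\bigwedge^kN^*_p$ for all $(g,p)\in\Lambda_0$, where $N^*_p=(T_pV/T_p(S^1p))^*$; that is, $\omega_{(g,p)}$ vanishes as soon as one of its arguments is tangent to the orbit of $p$. Then the following hold. 1. $\mathfrak{R}\circ i_Y=0$, so that $\mathfrak{R}$ is a chain map from $(\Omega^\bullet_{\mathrm{rel}}(S^1\times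 V),i_Y)$ to $\Omega^\bullet_{\mathrm{rel}}(\Lambda_0)$ with zero differential. 2. $\mathfrak{R}$ maps every cycle of $(\Omega^\bullet_{\mathrm{rel}}(S^1\times V),i_Y)$ to a horizontal relative form. 3. $\mathfrak{R}$ is a quasi-isomorphism onto the horizontal relative forms with zero differential: for every $k\ge 0$ the induced map $H_k\to\Omega^k_{\mathrm{hor}}(\Lambda_0)$, $[z]\mapsto\mathfrak{R}(z)$, is an isomorphism of $\mathbb{K}$-vector spaces. -/

import Mathlib

open scoped Manifold ContDiff
open TopologicalSpace (Opens)

noncomputable section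

namespace CircleLoop

/-! Throughout, `E` is a real normed space on which the circle acts by `ρ : Circle →* (E →L[ℝ] E)`,
`V` is an open subset of `E`, regarded as an open submanifold, and `𝕜` is `ℝ` or `ℂ`, the field in
which functions and differential forms take their values. -/

/-- The `k`-forms on `S¹ × V` relative to the projection `S¹ × V → S¹`: smooth families
`(g, v) ↦ α (g, v)` of alternating `ℝ`-multilinear `k`-forms on `T_v V = E` with values in `𝕜`. -/
@[ext]
structure RelForm (𝕜 : Type) [RCLike 𝕜] {E : Type} [NormedAddCommGroup E] [NormedSpace ℝ E]
    (V : Opens E) (k : ℕ) where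
  val : Circle × V → E [⋀^Fin k]→L[ℝ] 𝕜
  smooth : ContMDiff ((𝓡 1).prod 𝓘(ℝ, E)) 𝓘(ℝ, E [⋀^Fin k]→L[ℝ] 𝕜) ∞ val

/-! The pointwise vector space structure on relative forms. -/

namespace RelForm

variable {𝕜 : Type} [RCLike 𝕜] {E : Type} [NormedAddCommGroup E] [NormedSpace ℝ E]
  {V : Opens E} {k : ℕ}

instance : Zero (RelForm 𝕜 V k) := ⟨⟨fun _ => 0, contMDiff_const⟩⟩

instance : Add (RelForm 𝕜 V k) := ⟨fun α β => ⟨fun x => α.val x + β.val x, α.smooth.add β.smooth⟩⟩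

instance : Neg (RelForm 𝕜 V k) := ⟨fun α => ⟨fun x => -α.val x, α.smooth.neg⟩⟩

instance : SMul 𝕜 (RelForm 𝕜 V k) := ⟨fun c α => ⟨fun x => c • α.val x,
  (((ContinuousLinearMap.lsmul ℝ 𝕜 c : (E [⋀^Fin k]→L[ℝ] 𝕜) →L[ℝ] _)).contMDiff).comp α.smooth⟩⟩

@[simp] theorem zero_val (x : Circle × V) : (0 : RelForm 𝕜 V k).val x = 0 := rfl

@[simp] theorem add_val (α β : RelForm 𝕜 V k) (x : Circle × V) :
    (α + β).val x = α.val x + β.val x := rfl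

@[simp] theorem neg_val (α : RelForm 𝕜 V k) (x : Circle × V) : (-α).val x = -α.val x := rfl

@[simp] theorem smul_val (c : 𝕜) (α : RelForm 𝕜 V k) (x : Circle × V) :
    (c • α).val x = c • α.val x := rfl

instance : AddCommGroup (RelForm 𝕜 V k) where
  add_assoc a b c := RelForm.ext (funext fun x => add_assoc (a.val x) (b.val x) (c.val x))
  zero_add a := RelForm.ext (funext fun x => zero_add (a.val x))
  add_zero a := RelForm.ext (funext fun x => add_zero (a.val x))
  add_comm a b := RelForm.ext (funext fun x => add_comm (a.val x) (b.val x))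
  neg_add_cancel a := RelForm.ext (funext fun x => neg_add_cancel (a.val x))
  nsmul := nsmulRec
  zsmul := zsmulRec

instance : Module 𝕜 (RelForm 𝕜 V k) where
  one_smul a := RelForm.ext (funext fun x => one_smul 𝕜 (a.val x))
  mul_smul c d a := RelForm.ext (funext fun x => mul_smul c d (a.val x))
  smul_zero c := RelForm.ext (funext fun _ => smul_zero (A := E [⋀^Fin k]→L[ℝ] 𝕜) c)
  smul_add c a b := RelForm.ext (funext fun x => smul_add c (a.val x) (b.val x))
  add_smul c d a := RelForm.ext (funext fun x => add_smul c d (a.val x))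
  zero_smul a := RelForm.ext (funext fun x => zero_smul 𝕜 (a.val x))

end RelForm

/-- The vector field `Y (g, v) = v - g v`. -/
def fieldY {E : Type} [NormedAddCommGroup E] [NormedSpace ℝ E]
    (ρ : Circle →* (E →L[ℝ] E)) (V : Opens E) (x : Circle × V) : E :=
  (x.2 : E) - ρ x.1 (x.2 : E)

theorem contMDiff_fieldY {E : Type} [NormedAddCommGroup E] [NormedSpace ℝ E]
    (ρ : Circle →* (E →L[ℝ] E)) (hρ : ContMDiff (𝓡 1) 𝓘(ℝ, E →L[ℝ] E) ∞ ρ) (V : Opens E) :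
    ContMDiff ((𝓡 1).prod 𝓘(ℝ, E)) 𝓘(ℝ, E) ∞ (fieldY ρ V) := by
  have h1 : ContMDiff ((𝓡 1).prod 𝓘(ℝ, E)) 𝓘(ℝ, E) ∞ (fun x : Circle × V => (x.2 : E)) :=
    contMDiff_subtype_val.comp contMDiff_snd
  exact h1.sub ((hρ.comp contMDiff_fst).clm_apply h1)

theorem contMDiff_curryLeft_fieldY {E F : Type} [NormedAddCommGroup E] [NormedSpace ℝ E]
    [NormedAddCommGroup F] [NormedSpace ℝ F]
    (ρ : Circle →* (E →L[ℝ] E)) (hρ : ContMDiff (𝓡 1) 𝓘(ℝ, E →L[ℝ] E) ∞ ρ) (V : Opens E) (k : ℕ)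
    (α : Circle × V → E [⋀^Fin (k + 1)]→L[ℝ] F)
    (hα : ContMDiff ((𝓡 1).prod 𝓘(ℝ, E)) 𝓘(ℝ, E [⋀^Fin (k + 1)]→L[ℝ] F) ∞ α) :
    ContMDiff ((𝓡 1).prod 𝓘(ℝ, E)) 𝓘(ℝ, E [⋀^Fin k]→L[ℝ] F) ∞
      (fun x => (α x).curryLeft (fieldY ρ V x)) := by
  have hL : ContDiff ℝ ∞ (fun β : E [⋀^Fin (k + 1)]→L[ℝ] F => β.curryLeft) :=
    IsBoundedLinearMap.contDiff
      { map_add := fun _ _ => rfl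
        map_smul := fun _ _ => rfl
        bound := ⟨1, one_pos, fun β => by
          rw [one_mul]
          exact (ContinuousAlternatingMap.norm_curryLeft β).le⟩ }
  have h := hL.contMDiff.comp hα
  exact h.clm_apply (contMDiff_fieldY ρ hρ V)

/-- Contraction with `Y`, as a map from relative `(k+1)`-forms to relative `k`-forms:
`(i_Y α)(w₁, …, w_k) = α(Y, w₁, …, w_k)`. -/
def contractY (𝕜 : Type) [RCLike 𝕜] {E : Type} [NormedAddCommGroup E] [NormedSpace ℝ E]
    (ρ : Circle →* (E →L[ℝ] E)) (hρ : ContMDiff (𝓡 1) 𝓘(ℝ, E →L[ℝ] E) ∞ ρ)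
    (V : Opens E) (k : ℕ) : RelForm 𝕜 V (k + 1) →ₗ[𝕜] RelForm 𝕜 V k where
  toFun α := ⟨fun x => (α.val x).curryLeft (fieldY ρ V x),
    contMDiff_curryLeft_fieldY ρ hρ V k α.val α.smooth⟩
  map_add' _ _ := rfl
  map_smul' _ _ := rfl

/-- The Koszul cycles `Z_k`; in degree `0` the differential is zero. -/
def cycles (𝕜 : Type) [RCLike 𝕜] {E : Type} [NormedAddCommGroup E] [NormedSpace ℝ E]
    (ρ : Circle →* (E →L[ℝ] E)) (hρ : ContMDiff (𝓡 1) 𝓘(ℝ, E →L[ℝ] E) ∞ ρ)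
    (V : Opens E) : (k : ℕ) → Submodule 𝕜 (RelForm 𝕜 V k)
  | 0 => ⊤
  | k + 1 => LinearMap.ker (contractY 𝕜 ρ hρ V k)

/-- The Koszul boundaries `B_k`. -/
def boundaries (𝕜 : Type) [RCLike 𝕜] {E : Type} [NormedAddCommGroup E] [NormedSpace ℝ E]
    (ρ : Circle →* (E →L[ℝ] E)) (hρ : ContMDiff (𝓡 1) 𝓘(ℝ, E →L[ℝ] E) ∞ ρ)
    (V : Opens E) (k : ℕ) : Submodule 𝕜 (RelForm 𝕜 V k) :=
  LinearMap.range (contractY 𝕜 ρ hρ V k)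

/-- `i_Y ∘ i_Y = 0`. -/
theorem boundaries_le_cycles (𝕜 : Type) [RCLike 𝕜] {E : Type} [NormedAddCommGroup E]
    [NormedSpace ℝ E] (ρ : Circle →* (E →L[ℝ] E))
    (hρ : ContMDiff (𝓡 1) 𝓘(ℝ, E →L[ℝ] E) ∞ ρ) (V : Opens E) (k : ℕ) :
    boundaries 𝕜 ρ hρ V k ≤ cycles 𝕜 ρ hρ V k := by
  cases k with
  | zero => exact le_top
  | succ k =>
    rintro _ ⟨η, rfl⟩
    refine LinearMap.mem_ker.2 (RelForm.ext (funext fun x => ?_))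
    exact ContinuousAlternatingMap.curryLeft_same (η.val x) (fieldY ρ V x)

/-- The homology `Z_k / B_k` of the complex of relative forms with differential `i_Y`. -/
abbrev KoszulHomology (𝕜 : Type) [RCLike 𝕜] {E : Type} [NormedAddCommGroup E] [NormedSpace ℝ E]
    (ρ : Circle →* (E →L[ℝ] E)) (hρ : ContMDiff (𝓡 1) 𝓘(ℝ, E →L[ℝ] E) ∞ ρ)
    (V : Opens E) (k : ℕ) : Type :=
  cycles 𝕜 ρ hρ V k ⧸ (boundaries 𝕜 ρ hρ V k).submoduleOf (cycles 𝕜 ρ hρ V k)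

/-- The loop space `Λ₀(S¹ ⋉ V) = {(g, v) | g v = v}`. -/
def loopSpace {E : Type} [NormedAddCommGroup E] [NormedSpace ℝ E]
    (ρ : Circle →* (E →L[ℝ] E)) (V : Opens E) : Set (Circle × V) :=
  {x | ρ x.1 (x.2 : E) = (x.2 : E)}

/-- The vanishing ideal `𝒥` of the loop space: the smooth functions on `S¹ × V` that vanish
on `Λ₀`. -/
def vanishingIdeal (𝕜 : Type) [RCLike 𝕜] {E : Type} [NormedAddCommGroup E] [NormedSpace ℝ E]
    (ρ : Circle →* (E →L[ℝ] E)) (V : Opens E) : Set (Circle × V → 𝕜) :=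
  {f | ContMDiff ((𝓡 1).prod 𝓘(ℝ, E)) 𝓘(ℝ, 𝕜) ∞ f ∧ ∀ x ∈ loopSpace ρ V, f x = 0}

/-- The relative differential of a function on `S¹ × V`: at `(g, v)` it is the differential at `v`
of `f (g, ·)`. -/
def dRel {𝕜 : Type} [RCLike 𝕜] {E : Type} [NormedAddCommGroup E] [NormedSpace ℝ E]
    {V : Opens E} (f : Circle × V → 𝕜) (x : Circle × V) : E →L[ℝ] 𝕜 :=
  mfderiv 𝓘(ℝ, E) 𝓘(ℝ, 𝕜) (fun v : V => f (x.1, v)) x.2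

/-- The exterior product of a `1`-form and a `k`-form:
`(α ∧ β)(w₀, …, w_k) = ∑ i, (-1)^i α(w_i) β(w₀, …, ŵ_i, …, w_k)`. -/
def wedgeOne {𝕜 : Type} [RCLike 𝕜] {E : Type} [NormedAddCommGroup E] [NormedSpace ℝ E] {k : ℕ}
    (α : E →L[ℝ] 𝕜) (β : E [⋀^Fin k]→L[ℝ] 𝕜) : E [⋀^Fin (k + 1)]→L[ℝ] 𝕜 :=
  ContinuousAlternatingMap.alternatizeUncurryFin (α.smulRight β)

theorem wedgeOne_apply {𝕜 : Type} [RCLike 𝕜] {E : Type} [NormedAddCommGroup E] [NormedSpace ℝ E]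
    {k : ℕ} (α : E →L[ℝ] 𝕜) (β : E [⋀^Fin k]→L[ℝ] 𝕜) (w : Fin (k + 1) → E) :
    wedgeOne α β w = ∑ i : Fin (k + 1), (-1) ^ (i : ℕ) • (α (w i) * β (i.removeNth w)) := by
  simp [wedgeOne, ContinuousAlternatingMap.alternatizeUncurryFin_apply]

/-- The relative forms `𝒥 Ω^k`, spanned by the products `f α` with `f ∈ 𝒥`. -/
def idealTimesForms (𝕜 : Type) [RCLike 𝕜] {E : Type} [NormedAddCommGroup E] [NormedSpace ℝ E]
    (ρ : Circle →* (E →L[ℝ] E)) (V : Opens E) (k : ℕ) : Submodule 𝕜 (RelForm 𝕜 V k) :=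
  Submodule.span 𝕜
    {σ | ∃ f ∈ vanishingIdeal 𝕜 ρ V, ∃ α : RelForm 𝕜 V k, ∀ x, σ.val x = f x • α.val x}

/-- The relative forms `d_rel 𝒥 ∧ Ω^{k-1}`, spanned by the products `d_rel f ∧ η` with `f ∈ 𝒥`;
zero for `k = 0`. -/
def dIdealWedgeForms (𝕜 : Type) [RCLike 𝕜] {E : Type} [NormedAddCommGroup E] [NormedSpace ℝ E]
    (ρ : Circle →* (E →L[ℝ] E)) (V : Opens E) : (k : ℕ) → Submodule 𝕜 (RelForm 𝕜 V k)
  | 0 => ⊥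
  | k + 1 => Submodule.span 𝕜
      {σ | ∃ f ∈ vanishingIdeal 𝕜 ρ V, ∃ η : RelForm 𝕜 V k,
        ∀ x, σ.val x = wedgeOne (dRel f x) (η.val x)}

/-- The relative `k`-forms on the loop space,
`Ω^k(S¹ × V → S¹) / (𝒥 Ω^k + d_rel 𝒥 ∧ Ω^{k-1})`. -/
abbrev LoopForm (𝕜 : Type) [RCLike 𝕜] {E : Type} [NormedAddCommGroup E] [NormedSpace ℝ E]
    (ρ : Circle →* (E →L[ℝ] E)) (V : Opens E) (k : ℕ) : Type :=
  RelForm 𝕜 V k ⧸ (idealTimesForms 𝕜 ρ V k ⊔ dIdealWedgeForms 𝕜 ρ V k)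

/-- Restriction to the loop space, `α ↦ [α]`. -/
def restrict (𝕜 : Type) [RCLike 𝕜] {E : Type} [NormedAddCommGroup E] [NormedSpace ℝ E]
    (ρ : Circle →* (E →L[ℝ] E)) (V : Opens E) (k : ℕ) :
    RelForm 𝕜 V k →ₗ[𝕜] LoopForm 𝕜 ρ V k :=
  Submodule.mkQ _

/-- The tangent space `T_p 𝒪_p` at `p` of the orbit through `p`, spanned by the velocity at `p`
of the action. -/
def orbitTangent {E : Type} [NormedAddCommGroup E] [NormedSpace ℝ E]
    (ρ : Circle →* (E →L[ℝ] E)) (p : E) : Submodule ℝ E :=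
  Submodule.span ℝ {deriv (fun t : ℝ => ρ (Circle.exp t) p) 0}

/-- The relative forms `α` with `α (g, p) ∈ ⋀^k N*_p` for all `(g, p) ∈ Λ₀`, where
`N*_p = (T_p V / T_p 𝒪_p)*`: the value `α (g, p)` vanishes as soon as one of its arguments is
tangent to the orbit through `p`. -/
def conormalForms (𝕜 : Type) [RCLike 𝕜] {E : Type} [NormedAddCommGroup E] [NormedSpace ℝ E]
    (ρ : Circle →* (E →L[ℝ] E)) (V : Opens E) (k : ℕ) : Submodule 𝕜 (RelForm 𝕜 V k) where
  carrier := {α | ∀ x ∈ loopSpace ρ V, ∀ w : Fin k → E,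
    (∃ i, w i ∈ orbitTangent ρ (x.2 : E)) → α.val x w = 0}
  add_mem' {α β} h h' x hx w hw := by
    have e : (α + β).val x w = α.val x w + β.val x w := rfl
    rw [e, h x hx w hw, h' x hx w hw, add_zero]
  zero_mem' _ _ _ _ := rfl
  smul_mem' c α h x hx w hw := by
    change c • α.val x w = 0
    rw [h x hx w hw, smul_zero]

/-- The horizontal relative `k`-forms on the loop space: the classes that have a representative
`α` with `α (g, p) ∈ ⋀^k N*_p` for all `(g, p) ∈ Λ₀`. -/
def horizontalForms (𝕜 : Type) [RCLike 𝕜] {E : Type} [NormedAddCommGroup E] [NormedSpace ℝ E]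
    (ρ : Circle →* (E →L[ℝ] E)) (V : Opens E) (k : ℕ) : Submodule 𝕜 (LoopForm 𝕜 ρ V k) :=
  (conormalForms 𝕜 ρ V k).map (restrict 𝕜 ρ V k)

end CircleLoop

end

noncomputable section

namespace CircleLoop

open ContinuousAlternatingMap Filter Topology

/-! ### Smooth dependence on parameters -/

/-! Near a group element `g₀` write `g = g₀ exp (i s)`. Then `Y` is the linear field `v ↦ A s v`
with `A s = 1 - ρ (g₀ exp (i s))` (`fieldNear`), and the local question concerns the Koszul complex
of a smooth family of linear fields. Compactness and periodicity of the circle make `1 - ρ g₀` and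
the generator `X` semisimple (`one_sub_semisimple`, `generator_semisimple`). Hence `E` splits into
the range of a projection `Q`, where `A s` is invertible for small `s`, and its kernel, where `ρ g₀
= 1` and `A s = s N s` with `N 0 = -X`. For small `s`, `N s` is invertible on the range of a further
projection `P`, and it is zero on the kernel of `P` (`nonempty_localSplitting`).

Along an invertible block the Koszul complex contracts: integrating the `t`-derivative of the
pullbacks along `1 - Q + t Q` gives a homotopy from the pullback along `1 - Q` to the identity
(`homotopy_succ`, `homotopy_zero`). This removes the range of `Q`. The same homotopy for `N` and `P`
solves `γ = i_N ζ` whenever `i_N γ = 0` and `γ` pulls back to zero along `1 - P`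
(`eventually_eq_contract_N`). Only the factor `s` remains; it is divided out by Hadamard's lemma
(`exists_eq_smul_of_zero`), and identities known for `s ≠ 0` extend to `s = 0` by continuity
(`eq_zero_of_ne_zero`).

Injectivity: a cycle in the ideal, pulled back to the kernel of `Q`, is `s γ` with such a `γ`, hence
is `s i_N ζ = i_A ζ` there (`exists_eq_contract`). Surjectivity: for a horizontal `α`, the form `i_N
α` on the kernel of `Q` vanishes at `s = 0` because `N 0 = -X`. So it is `s η` with `η = i_N ζ`;
then `α - s ζ` is a cycle there, and `s ζ` lies in the ideal (`exists_eq_cycle_add`). That cycles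
are horizontal follows by differentiating `i_Y α = 0` in the group variable
(`curryLeft_generator_eq_zero`).

For the passage to `S¹ × V`, the submodule `𝒥 Ω + d_rel 𝒥 ∧ Ω` is identified in positive degree with
the forms `a(Y) + Alt(b ∘ (1 - ρ))` for smooth `a`, `b` (`exists_hadamard`, `exists_eq_of_mem_sup`,
`mem_sup`). All local problems are then affine in their unknowns, so local solutions glue by a
partition of unity (`exists_contMDiff_forall_mem_of_local`). -/

theorem eq_zero_of_ne_zero {H F : Type} [TopologicalSpace H] [TopologicalSpace F] [T2Space F]
    [Zero F] {f : ℝ × H → F} (hf : Continuous f)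
    (h : ∀ s, s ≠ 0 → ∀ v, f (s, v) = 0) (s : ℝ) (v : H) : f (s, v) = 0 := by
  have hd : Dense ({0}ᶜ : Set ℝ) := dense_compl_singleton 0
  have := Continuous.ext_on hd (hf.comp (by fun_prop : Continuous fun s : ℝ => (s, v)))
    (continuous_const (y := (0 : F))) fun s hs => h s hs v
  exact congrFun this s

section Calculus

variable {H F G : Type} [NormedAddCommGroup H] [NormedSpace ℝ H] [NormedAddCommGroup F]
  [NormedSpace ℝ F] [NormedAddCommGroup G] [NormedSpace ℝ G]

theorem hasFDerivAt_integral_zero_one [FiniteDimensional ℝ H] [CompleteSpace F] {f : H × ℝ → F}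
    (hf : ContDiff ℝ 1 f) (x₀ : H) :
    HasFDerivAt (fun x => ∫ t in (0 : ℝ)..1, f (x, t))
      (∫ t in (0 : ℝ)..1, (fderiv ℝ f (x₀, t)).comp (ContinuousLinearMap.inl ℝ H ℝ)) x₀ := by
  have hc : Continuous fun p : H × ℝ =>
      (fderiv ℝ f p).comp (ContinuousLinearMap.inl ℝ H ℝ) :=
    (hf.continuous_fderiv one_ne_zero).clm_comp continuous_const
  -- The dominating function is a constant: the derivative is bounded on the compact set of a closed
  -- ball times `[0, 1]`.
  obtain ⟨C, hC⟩ := ((isCompact_closedBall x₀ 1).prod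
    (isCompact_Icc (a := (0 : ℝ)) (b := 1))).exists_bound_of_continuousOn hc.continuousOn
  refine intervalIntegral.hasFDerivAt_integral_of_dominated_of_fderiv_le
    (F := fun x t => f (x, t)) (bound := fun _ => C)
    (F' := fun x t => (fderiv ℝ f (x, t)).comp (ContinuousLinearMap.inl ℝ H ℝ))
    (Metric.closedBall_mem_nhds x₀ one_pos) (Eventually.of_forall fun x => ?_) ?_ ?_ ?_
    intervalIntegrable_const ?_
  · exact (hf.continuous.comp (by fun_prop : Continuous fun t : ℝ => (x, t))).aestronglyMeasurable
  · exact (hf.continuous.comp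
      (by fun_prop : Continuous fun t : ℝ => (x₀, t))).intervalIntegrable _ _
  · exact (hc.comp (by fun_prop : Continuous fun t : ℝ => (x₀, t))).aestronglyMeasurable
  · refine Eventually.of_forall fun t ht x hx => hC (x, t) ⟨hx, ?_⟩
    rw [Set.uIoc_of_le zero_le_one] at ht
    exact ⟨ht.1.le, ht.2⟩
  · refine Eventually.of_forall fun t _ x _ => ?_
    exact ((hf.differentiable one_ne_zero) (x, t)).hasFDerivAt.comp x (hasFDerivAt_prodMk_left x t)

/-- The derivative of the integral is again such an integral, with values in `H →L[ℝ] F`. The target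
space is therefore quantified inside the induction on the order. -/
theorem contDiff_integral_zero_one_nat [FiniteDimensional ℝ H] (n : ℕ) :
    ∀ {F : Type} [NormedAddCommGroup F] [NormedSpace ℝ F] [CompleteSpace F] {f : H × ℝ → F},
    ContDiff ℝ ∞ f → ContDiff ℝ n fun x => ∫ t in (0 : ℝ)..1, f (x, t) := by
  induction n with
  | zero =>
    intro F _ _ _ f hf
    refine contDiff_zero.2 (continuous_iff_continuousAt.2 fun x => ?_)
    exact (hasFDerivAt_integral_zero_one (hf.of_le (by exact_mod_cast le_top)) x).continuousAt
  | succ n ih =>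
    intro F _ _ _ f hf
    refine (contDiff_succ_iff_hasFDerivAt (n := n)).2 ⟨_, ih (f := fun p : H × ℝ =>
      (fderiv ℝ f p).comp (ContinuousLinearMap.inl ℝ H ℝ)) ?_, fun x =>
      hasFDerivAt_integral_zero_one (hf.of_le (by exact_mod_cast le_top)) x⟩
    exact (hf.fderiv_right (m := ∞) (by simp)).clm_comp contDiff_const

theorem contDiff_integral_zero_one [FiniteDimensional ℝ H] [CompleteSpace F] {f : H × ℝ → F}
    (hf : ContDiff ℝ ∞ f) : ContDiff ℝ ∞ fun x => ∫ t in (0 : ℝ)..1, f (x, t) :=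
  contDiff_infty.2 fun n => contDiff_integral_zero_one_nat n hf

/-- Hadamard's lemma: a smooth function that vanishes for `s = 0` is divisible by `s`. -/
theorem exists_eq_smul_of_zero [FiniteDimensional ℝ H] [CompleteSpace F] {f : ℝ × H → F}
    (hf : ContDiff ℝ ∞ f) (h0 : ∀ v, f (0, v) = 0) :
    ∃ γ : ℝ × H → F, ContDiff ℝ ∞ γ ∧ ∀ s v, f (s, v) = s • γ (s, v) := by
  have hD : ContDiff ℝ ∞ fun p => fderiv ℝ f p (1, 0) :=
    (hf.fderiv_right (m := ∞) (by simp)).clm_apply contDiff_const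
  refine ⟨fun p => ∫ t in (0 : ℝ)..1, fderiv ℝ f (t * p.1, p.2) (1, 0),
    contDiff_integral_zero_one (f := fun q : (ℝ × H) × ℝ => fderiv ℝ f (q.2 * q.1.1, q.1.2) (1, 0))
      (hD.comp (by fun_prop : ContDiff ℝ ∞ fun q : (ℝ × H) × ℝ => (q.2 * q.1.1, q.1.2))),
    fun s v => ?_⟩
  have hc : Continuous fun t : ℝ => fderiv ℝ f (t * s, v) (1, 0) :=
    hD.continuous.comp (by fun_prop : Continuous fun t : ℝ => (t * s, v))
  have h : ∀ t : ℝ, HasDerivAt (fun t : ℝ => f (t * s, v)) (s • fderiv ℝ f (t * s, v) (1, 0)) t := by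
    intro t
    have h1 : HasDerivAt (fun t : ℝ => (t * s, v)) (s, 0) t := by
      simpa using ((hasDerivAt_id t).mul_const s).prodMk (hasDerivAt_const t v)
    have h2 := ((hf.differentiable (by simp)) (t * s, v)).hasFDerivAt.comp_hasDerivAt t h1
    have h3 : ((s, 0) : ℝ × H) = s • (1, 0) := by simp
    rwa [h3, map_smul] at h2
  have := intervalIntegral.integral_eq_sub_of_hasDerivAt (fun t _ => h t)
    ((hc.const_smul s).intervalIntegrable 0 1)
  rw [intervalIntegral.integral_smul] at this
  simpa [h0] using this.symm

end Calculus

/-! ### Pullback, contraction and exterior product of alternating forms -/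

section Alternating

variable {H E F : Type} [NormedAddCommGroup H] [NormedSpace ℝ H]
  [NormedAddCommGroup E] [NormedSpace ℝ E] [NormedAddCommGroup F] [NormedSpace ℝ F] {k : ℕ}

theorem isBoundedBilinearMap_curryLeft :
    IsBoundedBilinearMap ℝ fun p : (E [⋀^Fin (k + 1)]→L[ℝ] F) × E => p.1.curryLeft p.2 where
  add_left _ _ _ := rfl
  smul_left _ _ _ := rfl
  add_right _ _ _ := map_add _ _ _
  smul_right _ _ _ := map_smul _ _ _
  bound := ⟨1, one_pos, fun α u => by
    rw [one_mul, ← norm_curryLeft]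
    exact α.curryLeft.le_opNorm u⟩

/-- Contraction with a vector, as a continuous linear map. -/
def contractCLM (F : Type) [NormedAddCommGroup F] [NormedSpace ℝ F] (k : ℕ) (u : E) :
    (E [⋀^Fin (k + 1)]→L[ℝ] F) →L[ℝ] E [⋀^Fin k]→L[ℝ] F :=
  (isBoundedBilinearMap_curryLeft.isBoundedLinearMap_left u).toContinuousLinearMap

@[simp]
theorem contractCLM_apply (u : E) (α : E [⋀^Fin (k + 1)]→L[ℝ] F) :
    contractCLM F k u α = α.curryLeft u :=
  rfl

theorem ContDiff.curryLeft_apply {n : WithTop ℕ∞} {f : H → E [⋀^Fin (k + 1)]→L[ℝ] F} {g : H → E}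
    (hf : ContDiff ℝ n f) (hg : ContDiff ℝ n g) : ContDiff ℝ n fun x => (f x).curryLeft (g x) :=
  (isBoundedBilinearMap_curryLeft (E := E) (F := F) (k := k)).contDiff.comp (hf.prodMk hg)

theorem contDiff_alternatizeUncurryFin {n : WithTop ℕ∞} :
    ContDiff ℝ n fun f : E →L[ℝ] E [⋀^Fin k]→L[ℝ] F => alternatizeUncurryFin f :=
  have h : ContDiff ℝ n (alternatizeUncurryFinCLM ℝ E F :
      (E →L[ℝ] E [⋀^Fin k]→L[ℝ] F) →L[ℝ] _) := ContinuousLinearMap.contDiff _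
  h

/-- Alternating the curried form multiplies it by its degree, so a form is recovered from its
contractions. This permits induction on the degree. -/
theorem contDiff_iff_curryLeft [FiniteDimensional ℝ E] {n : WithTop ℕ∞}
    {f : H → E [⋀^Fin (k + 1)]→L[ℝ] F} :
    ContDiff ℝ n f ↔ ∀ u, ContDiff ℝ n fun x => (f x).curryLeft u := by
  refine ⟨fun h u => ContDiff.curryLeft_apply h contDiff_const, fun h => ?_⟩
  have h1 : ContDiff ℝ n fun x => alternatizeUncurryFin (f x).curryLeft :=
    contDiff_alternatizeUncurryFin.comp (contDiff_clm_apply_iff.2 h)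
  have h2 : f = fun x => ((k + 1 : ℕ) : ℝ)⁻¹ • alternatizeUncurryFin (f x).curryLeft := by
    funext x
    rw [alternatizeUncurryFin_curryLeft, ← Nat.cast_smul_eq_nsmul ℝ, smul_smul,
      inv_mul_cancel₀ (by positivity), one_smul]
  rw [h2]
  exact h1.const_smul _

theorem contDiff_compContinuousLinearMap [FiniteDimensional ℝ E] {n : WithTop ℕ∞} :
    ∀ {k : ℕ} {f : H → E [⋀^Fin k]→L[ℝ] F} {g : H → E →L[ℝ] E}, ContDiff ℝ n f → ContDiff ℝ n g →
      ContDiff ℝ n fun x => (f x).compContinuousLinearMap (g x) := by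
  intro k
  induction k with
  | zero =>
    intro f g hf hg
    have : (fun x => (f x).compContinuousLinearMap (g x)) = f := by
      funext x
      ext v
      simp [Subsingleton.elim (g x ∘ v) v]
    rwa [this]
  | succ k ih =>
    intro f g hf hg
    refine contDiff_iff_curryLeft.2 fun u => ?_
    simp only [curryLeft_compContinuousLinearMap]
    exact ih (ContDiff.curryLeft_apply hf (hg.clm_apply contDiff_const)) hg

/-- This is the antiderivation rule `i_u (l ∧ β) = l(u) β - l ∧ i_u β`, for sums of tensors `l ⊗ β`:
the term `i = 0` of the alternating sum is split off. -/
theorem curryLeft_alternatizeUncurryFin (f : E →L[ℝ] E [⋀^Fin (k + 1)]→L[ℝ] F) (u : E) :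
    (alternatizeUncurryFin f).curryLeft u =
      f u - alternatizeUncurryFin ((contractCLM F k u).comp f) := by
  ext w
  rw [curryLeft_apply_apply, alternatizeUncurryFin_apply, Fin.sum_univ_succ,
    ContinuousAlternatingMap.sub_apply]
  simp only [ alternatizeUncurryFin_apply, sub_eq_add_neg,
    ← Finset.sum_neg_distrib]
  congr 1
  · simp
  · refine Finset.sum_congr rfl fun i _ => ?_
    simp only [Fin.val_succ, pow_succ, Matrix.cons_val_succ]
    have : Fin.removeNth i.succ (Matrix.vecCons u w) = Matrix.vecCons u (Fin.removeNth i w) := by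
      funext j
      refine Fin.cases ?_ (fun j => ?_) j <;> simp [Fin.removeNth]
    rw [this]
    simp

theorem curryLeft_alternatizeUncurryFin_zero (f : E →L[ℝ] E [⋀^Fin 0]→L[ℝ] F) (u : E) :
    (alternatizeUncurryFin f).curryLeft u = f u := by
  ext w
  rw [curryLeft_apply_apply, alternatizeUncurryFin_apply, Fin.sum_univ_succ]
  simp [Subsingleton.elim _ w]

theorem compContinuousLinearMap_alternatizeUncurryFin (f : E →L[ℝ] E [⋀^Fin k]→L[ℝ] F)
    (C : E →L[ℝ] E) :
    (alternatizeUncurryFin f).compContinuousLinearMap C =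
      alternatizeUncurryFin ((compContinuousLinearMapCLM C).comp (f.comp C)) := by
  ext w
  simp [alternatizeUncurryFin_apply]
  rfl

end Alternating

end CircleLoop

namespace CircleLoop

open ContinuousAlternatingMap Filter Topology

/-! ### The Koszul homotopy along a linear projection -/

theorem integral_clm_apply {E W : Type} [NormedAddCommGroup E] [NormedSpace ℝ E]
    [NormedAddCommGroup W] [NormedSpace ℝ W] [CompleteSpace W]
    {f : ℝ → E →L[ℝ] W} (hf : Continuous f) (u : E) :
    (∫ t in (0 : ℝ)..1, f t) u = ∫ t in (0 : ℝ)..1, f t u :=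
  ContinuousLinearMap.intervalIntegral_apply (hf.intervalIntegrable 0 1) u

theorem clm_integral {W W' : Type} [NormedAddCommGroup W] [NormedSpace ℝ W] [CompleteSpace W]
    [NormedAddCommGroup W'] [NormedSpace ℝ W'] [CompleteSpace W'] (L : W →L[ℝ] W')
    {f : ℝ → W} (hf : Continuous f) :
    L (∫ t in (0 : ℝ)..1, f t) = ∫ t in (0 : ℝ)..1, L (f t) :=
  (L.intervalIntegral_comp_comm (hf.intervalIntegrable 0 1)).symm

theorem clm_integral_clm {E W W' : Type} [NormedAddCommGroup E] [NormedSpace ℝ E]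
    [NormedAddCommGroup W] [NormedSpace ℝ W] [CompleteSpace W]
    [NormedAddCommGroup W'] [NormedSpace ℝ W'] [CompleteSpace W'] (L : (E →L[ℝ] W) →L[ℝ] W')
    {f : ℝ → E →L[ℝ] W} (hf : Continuous f) :
    L (∫ t in (0 : ℝ)..1, f t) = ∫ t in (0 : ℝ)..1, L (f t) :=
  clm_integral L hf

theorem alternatizeUncurryFin_integral {E F : Type} [NormedAddCommGroup E] [NormedSpace ℝ E]
    [NormedAddCommGroup F] [NormedSpace ℝ F] [CompleteSpace F] {k : ℕ}
    {f : ℝ → E →L[ℝ] E [⋀^Fin k]→L[ℝ] F} (hf : Continuous f) :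
    alternatizeUncurryFin (∫ t in (0 : ℝ)..1, f t) =
      ∫ t in (0 : ℝ)..1, alternatizeUncurryFin (f t) := by
  have h := clm_integral_clm
    (alternatizeUncurryFinCLM ℝ E F : (E →L[ℝ] E [⋀^Fin k]→L[ℝ] F) →L[ℝ] _) hf
  exact h

section Homotopy

variable {E F : Type} [NormedAddCommGroup E] [NormedSpace ℝ E] [NormedAddCommGroup F]
  [NormedSpace ℝ F] {k : ℕ}

/-- The operator `1 - Q + t Q`, which scales the range of a projection `Q` by `t`. -/
def scaleAlong (Q : E →L[ℝ] E) (t : ℝ) : E →L[ℝ] E := 1 - Q + t • Q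

theorem contDiff_scaleAlong (Q : E →L[ℝ] E) : ContDiff ℝ ∞ (scaleAlong Q) := by
  unfold scaleAlong
  fun_prop

theorem scaleAlong_zero (Q : E →L[ℝ] E) : scaleAlong Q 0 = 1 - Q := by simp [scaleAlong]

theorem scaleAlong_one (Q : E →L[ℝ] E) : scaleAlong Q 1 = 1 := by simp [scaleAlong]

theorem hasDerivAt_scaleAlong (Q : E →L[ℝ] E) (t : ℝ) : HasDerivAt (scaleAlong Q) Q t := by
  have h := ((hasDerivAt_id t).smul_const Q).const_add (1 - Q)
  rw [one_smul] at h
  exact h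

theorem commute_scaleAlong {A Q : E →L[ℝ] E} (h : Commute A Q) (t : ℝ) :
    Commute A (scaleAlong Q t) :=
  ((Commute.one_right A).sub_right h).add_right (h.smul_right t)

/-- The pullback of a family of forms along the linear map `C`. -/
def pull (C : E →L[ℝ] E) (α : ℝ × E → E [⋀^Fin k]→L[ℝ] F) (p : ℝ × E) : E [⋀^Fin k]→L[ℝ] F :=
  (α (p.1, C p.2)).compContinuousLinearMap C

theorem contDiff_pull [FiniteDimensional ℝ E] (C : E →L[ℝ] E) {α : ℝ × E → E [⋀^Fin k]→L[ℝ] F}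
    (hα : ContDiff ℝ ∞ α) : ContDiff ℝ ∞ (pull C α) :=
  contDiff_compContinuousLinearMap
    (hα.comp (by fun_prop : ContDiff ℝ ∞ fun p : ℝ × E => (p.1, C p.2))) contDiff_const

/-- The contraction of a family of forms with the vector field `(s, v) ↦ A s v`. -/
def contract (A : ℝ → E →L[ℝ] E) (α : ℝ × E → E [⋀^Fin (k + 1)]→L[ℝ] F) (p : ℝ × E) :
    E [⋀^Fin k]→L[ℝ] F :=
  (α p).curryLeft (A p.1 p.2)

theorem contDiff_field {A : ℝ → E →L[ℝ] E} (hA : ContDiff ℝ ∞ A) :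
    ContDiff ℝ ∞ fun p : ℝ × E => A p.1 p.2 :=
  (hA.comp contDiff_fst).clm_apply contDiff_snd

theorem contDiff_contract {A : ℝ → E →L[ℝ] E} (hA : ContDiff ℝ ∞ A)
    {α : ℝ × E → E [⋀^Fin (k + 1)]→L[ℝ] F} (hα : ContDiff ℝ ∞ α) : ContDiff ℝ ∞ (contract A α) :=
  ContDiff.curryLeft_apply hα (contDiff_field hA)

/-- Leibniz rule in the directions of `E`. The field is linear in `v`, so its derivative there is `A
s` itself. -/
theorem fderiv_contract {A : ℝ → E →L[ℝ] E} (hA : ContDiff ℝ ∞ A)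
    {α : ℝ × E → E [⋀^Fin (k + 1)]→L[ℝ] F} (hα : ContDiff ℝ ∞ α) (s : ℝ) (y u : E) :
    fderiv ℝ (contract A α) (s, y) (0, u) =
      (fderiv ℝ α (s, y) (0, u)).curryLeft (A s y) + (α (s, y)).curryLeft (A s u) := by
  have h1 : HasFDerivAt α (fderiv ℝ α (s, y)) (s, y) :=
    ((hα.differentiable (by simp)) _).hasFDerivAt
  have h2 : HasFDerivAt (fun p : ℝ × E => A p.1 p.2) _ (s, y) :=
    (((hA.differentiable (by simp) s).hasFDerivAt.comp (s, y) hasFDerivAt_fst).clm_apply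
      hasFDerivAt_snd)
  have h3 := ((isBoundedBilinearMap_curryLeft (E := E) (F := F) (k := k)).hasFDerivAt
    (α (s, y), A s y)).comp (s, y) (h1.prodMk h2)
  have h4 : contract A α = (fun p : (E [⋀^Fin (k + 1)]→L[ℝ] F) × E => p.1.curryLeft p.2) ∘
      fun p : ℝ × E => (α p, A p.1 p.2) := rfl
  rw [h4, h3.fderiv]
  simp [add_comm]

/-- The integrand of the Koszul homotopy. -/
def homotopyIntegrand (Q : E →L[ℝ] E) (α : ℝ × E → E [⋀^Fin k]→L[ℝ] F) (q : (ℝ × E) × ℝ) :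
    E →L[ℝ] E [⋀^Fin k]→L[ℝ] F :=
  (compContinuousLinearMapCLM (scaleAlong Q q.2)).comp
    ((fderiv ℝ α (q.1.1, scaleAlong Q q.2 q.1.2)).comp (ContinuousLinearMap.inr ℝ ℝ E))

theorem homotopyIntegrand_apply (Q : E →L[ℝ] E) (α : ℝ × E → E [⋀^Fin k]→L[ℝ] F)
    (q : (ℝ × E) × ℝ) (u : E) :
    homotopyIntegrand Q α q u = (fderiv ℝ α (q.1.1, scaleAlong Q q.2 q.1.2)
      (0, u)).compContinuousLinearMap (scaleAlong Q q.2) := by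
  simp [homotopyIntegrand]

theorem contDiff_homotopyIntegrand [FiniteDimensional ℝ E] (Q : E →L[ℝ] E)
    {α : ℝ × E → E [⋀^Fin k]→L[ℝ] F} (hα : ContDiff ℝ ∞ α) :
    ContDiff ℝ ∞ (homotopyIntegrand Q α) := by
  refine contDiff_clm_apply_iff.2 fun u => ?_
  simp only [homotopyIntegrand_apply]
  have h1 : ContDiff ℝ ∞ fun q : (ℝ × E) × ℝ => scaleAlong Q q.2 :=
    (contDiff_scaleAlong Q).comp contDiff_snd
  have h2 : ContDiff ℝ ∞ fun q : (ℝ × E) × ℝ => (q.1.1, scaleAlong Q q.2 q.1.2) :=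
    (contDiff_fst.comp contDiff_fst).prodMk (h1.clm_apply (contDiff_snd.comp contDiff_fst))
  exact contDiff_compContinuousLinearMap
    (((hα.fderiv_right (m := ∞) (by simp)).comp h2).clm_apply contDiff_const) h1

/-- The coefficient of the Koszul homotopy along `Q`: the integral over `t` of the pullback along
`scaleAlong Q t` of the derivative of `α` in the direction of `E`. -/
def homotopyCoeff (Q : E →L[ℝ] E) (α : ℝ × E → E [⋀^Fin k]→L[ℝ] F) (p : ℝ × E) :
    E →L[ℝ] E [⋀^Fin k]→L[ℝ] F :=
  ∫ t in (0 : ℝ)..1, homotopyIntegrand Q α (p, t)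

/-- The pullback depends on `t` through the base point and through the arguments of the form, and
each contributes one summand. -/
theorem hasDerivAt_pull_scaleAlong (Q : E →L[ℝ] E) {α : ℝ × E → E [⋀^Fin k]→L[ℝ] F}
    (hα : ContDiff ℝ ∞ α) (p : ℝ × E) (t : ℝ) :
    HasDerivAt (fun t => pull (scaleAlong Q t) α p) (homotopyIntegrand Q α (p, t) (Q p.2) +
      (α (p.1, scaleAlong Q t p.2)).fderivCompContinuousLinearMap (scaleAlong Q t) Q) t := by
  have h1 := hasDerivAt_scaleAlong Q t
  have h2 : HasDerivAt (fun t : ℝ => (p.1, scaleAlong Q t p.2)) (0, Q p.2) t := by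
    refine (hasDerivAt_const t p.1).prodMk ?_
    simpa using h1.clm_apply (hasDerivAt_const t p.2)
  have h3 := ((hα.differentiable (by simp)) (p.1, scaleAlong Q t p.2)).hasFDerivAt.comp_hasDerivAt
    t h2
  have h4 := (h3.hasFDerivAt.continuousAlternatingMapCompContinuousLinearMap
    h1.hasFDerivAt).hasDerivAt
  have e : homotopyIntegrand Q α (p, t) (Q p.2) +
      (α (p.1, scaleAlong Q t p.2)).fderivCompContinuousLinearMap (scaleAlong Q t) Q = _ :=
    congrArg₂ (· + ·) (homotopyIntegrand_apply Q α (p, t) (Q p.2)) rfl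
  rw [e]
  simpa using! h4

variable [FiniteDimensional ℝ E]

theorem contDiff_homotopyCoeff [CompleteSpace F] (Q : E →L[ℝ] E)
    {α : ℝ × E → E [⋀^Fin k]→L[ℝ] F}
    (hα : ContDiff ℝ ∞ α) : ContDiff ℝ ∞ (homotopyCoeff Q α) :=
  contDiff_integral_zero_one (contDiff_homotopyIntegrand Q hα)

theorem continuous_homotopyIntegrand (Q : E →L[ℝ] E) {α : ℝ × E → E [⋀^Fin k]→L[ℝ] F}
    (hα : ContDiff ℝ ∞ α) (p : ℝ × E) : Continuous fun t => homotopyIntegrand Q α (p, t) :=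
  (contDiff_homotopyIntegrand Q hα).continuous.comp (by fun_prop : Continuous fun t : ℝ => (p, t))

/-- The integrand of the correction term in the fundamental theorem of calculus for pullbacks. -/
theorem continuous_correction (Q : E →L[ℝ] E) {α : ℝ × E → E [⋀^Fin (k + 1)]→L[ℝ] F}
    (hα : ContDiff ℝ ∞ α) (p : ℝ × E) : Continuous fun t : ℝ =>
      ((compContinuousLinearMapCLM (scaleAlong Q t)).comp
        (α (p.1, scaleAlong Q t p.2)).curryLeft).comp Q := by
  have h1 := contDiff_scaleAlong Q
  have h2 : ContDiff ℝ ∞ fun t : ℝ => (p.1, scaleAlong Q t p.2) :=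
    contDiff_const.prodMk (h1.clm_apply contDiff_const)
  refine ContDiff.continuous (𝕜 := ℝ) (n := ∞) (contDiff_clm_apply_iff.2 fun u => ?_)
  exact contDiff_compContinuousLinearMap
    (ContDiff.curryLeft_apply (hα.comp h2) contDiff_const) h1

variable [CompleteSpace F]

theorem sub_pull_zero (Q : E →L[ℝ] E) {α : ℝ × E → E [⋀^Fin 0]→L[ℝ] F}
    (hα : ContDiff ℝ ∞ α) (p : ℝ × E) :
    α p - pull (1 - Q) α p = homotopyCoeff Q α p (Q p.2) := by
  have hi := continuous_homotopyIntegrand Q hα p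
  have hc : Continuous fun t : ℝ => homotopyIntegrand Q α (p, t) (Q p.2) :=
    hi.clm_apply continuous_const
  have h := intervalIntegral.integral_eq_sub_of_hasDerivAt
    (fun t _ => hasDerivAt_pull_scaleAlong Q hα p t) (a := 0) (b := 1)
  simp only [fderivCompContinuousLinearMap_of_isEmpty, Pi.zero_apply,
    _root_.zero_apply, add_zero] at h
  rw [homotopyCoeff, integral_clm_apply hi,
    h (hc.intervalIntegrable _ _), scaleAlong_zero, scaleAlong_one]
  congr 1

/-- Fundamental theorem of calculus between `t = 0`, where the scaling is `1 - Q`, and `t = 1`,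
where it is the identity. The second summand comes from moving the arguments; it is absent in degree
zero. -/
theorem sub_pull_succ (Q : E →L[ℝ] E) {α : ℝ × E → E [⋀^Fin (k + 1)]→L[ℝ] F}
    (hα : ContDiff ℝ ∞ α) (p : ℝ × E) :
    α p - pull (1 - Q) α p = homotopyCoeff Q α p (Q p.2) +
      alternatizeUncurryFin (∫ t in (0 : ℝ)..1,
        ((compContinuousLinearMapCLM (scaleAlong Q t)).comp
          (α (p.1, scaleAlong Q t p.2)).curryLeft).comp Q) := by
  have hi := continuous_homotopyIntegrand Q hα p
  have hc : Continuous fun t : ℝ => homotopyIntegrand Q α (p, t) (Q p.2) :=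
    hi.clm_apply continuous_const
  have hd := continuous_correction Q hα p
  have hd' : Continuous fun t : ℝ => alternatizeUncurryFin
      (((compContinuousLinearMapCLM (scaleAlong Q t)).comp
        (α (p.1, scaleAlong Q t p.2)).curryLeft).comp Q) :=
    (contDiff_alternatizeUncurryFin (n := 0)).continuous.comp hd
  have h := intervalIntegral.integral_eq_sub_of_hasDerivAt
    (fun t _ => hasDerivAt_pull_scaleAlong Q hα p t) (a := 0) (b := 1)
  simp only [fderivCompContinuousLinearMap_eq_alternatizeUncurryFin] at h
  have h' := h ((hc.add hd').intervalIntegrable _ _)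
  rw [homotopyCoeff, integral_clm_apply hi, alternatizeUncurryFin_integral hd,
    ← intervalIntegral.integral_add (hc.intervalIntegrable _ _) (hd'.intervalIntegrable _ _)]
  refine Eq.trans ?_ h'.symm
  rw [scaleAlong_zero, scaleAlong_one]
  congr 1

/-- Differentiating the contraction gives two terms. In the first, `A` commutes with the scaling, so
the contraction leaves the integral. In the second, `A G = Q` produces exactly the correction
integral of `sub_pull_succ`, which makes the terms cancel in the homotopy formula. -/
theorem homotopyCoeff_contract {A : ℝ → E →L[ℝ] E} (hA : ContDiff ℝ ∞ A) {Q G : E →L[ℝ] E}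
    {α : ℝ × E → E [⋀^Fin (k + 1)]→L[ℝ] F} (hα : ContDiff ℝ ∞ α) (p : ℝ × E)
    (hAQ : Commute (A p.1) Q) (hAG : A p.1 * G = Q) :
    (homotopyCoeff Q (contract A α) p).comp G =
      (contractCLM F k (A p.1 p.2)).comp ((homotopyCoeff Q α p).comp G) +
      ∫ t in (0 : ℝ)..1, ((compContinuousLinearMapCLM (scaleAlong Q t)).comp
          (α (p.1, scaleAlong Q t p.2)).curryLeft).comp Q := by
  have hi := continuous_homotopyIntegrand Q hα p
  have hi' := continuous_homotopyIntegrand Q (contDiff_contract hA hα) p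
  have hd := continuous_correction Q hα p
  ext1 w
  have hc : Continuous fun t : ℝ => homotopyIntegrand Q α (p, t) (G w) :=
    hi.clm_apply continuous_const
  have hd' : Continuous fun t : ℝ => (((compContinuousLinearMapCLM (scaleAlong Q t)).comp
      (α (p.1, scaleAlong Q t p.2)).curryLeft).comp Q) w := hd.clm_apply continuous_const
  have hc' : Continuous fun t : ℝ =>
      contractCLM F k (A p.1 p.2) (homotopyIntegrand Q α (p, t) (G w)) :=
    (contractCLM F k (A p.1 p.2)).continuous.comp hc
  have h1 : homotopyCoeff Q (contract A α) p (G w) =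
      ∫ t in (0 : ℝ)..1, homotopyIntegrand Q (contract A α) (p, t) (G w) :=
    integral_clm_apply hi' _
  have h2 : contractCLM F k (A p.1 p.2) (homotopyCoeff Q α p (G w)) =
      ∫ t in (0 : ℝ)..1, contractCLM F k (A p.1 p.2) (homotopyIntegrand Q α (p, t) (G w)) := by
    rw [homotopyCoeff, integral_clm_apply hi, clm_integral _ hc]
  rw [_root_.add_apply, ContinuousLinearMap.comp_apply,
    ContinuousLinearMap.comp_apply, ContinuousLinearMap.comp_apply, integral_clm_apply hd, h1, h2,
    ← intervalIntegral.integral_add (hc'.intervalIntegrable _ _) (hd'.intervalIntegrable _ _)]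
  congr 1
  funext t
  have hcomm : A p.1 (scaleAlong Q t p.2) = scaleAlong Q t (A p.1 p.2) :=
    congrArg (fun B : E →L[ℝ] E => B p.2) (commute_scaleAlong hAQ t).eq
  have hG : A p.1 (G w) = Q w := congrArg (fun B : E →L[ℝ] E => B w) hAG
  rw [homotopyIntegrand_apply, fderiv_contract hA hα, contractCLM_apply, homotopyIntegrand_apply,
    curryLeft_compContinuousLinearMap, hcomm, hG]
  ext
  simp

/-- The Koszul homotopy: contraction with `A` and the operator
`α ↦ alternatizeUncurryFin (homotopyCoeff Q α ∘ G)` have as anticommutator the difference of the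
identity and the pullback along `1 - Q`. -/
theorem homotopy_succ {A : ℝ → E →L[ℝ] E} (hA : ContDiff ℝ ∞ A) {Q G : E →L[ℝ] E}
    {α : ℝ × E → E [⋀^Fin (k + 1)]→L[ℝ] F} (hα : ContDiff ℝ ∞ α) (p : ℝ × E)
    (hAQ : Commute (A p.1) Q) (hAG : A p.1 * G = Q) (hGA : G * A p.1 = Q) :
    α p = pull (1 - Q) α p +
      (alternatizeUncurryFin ((homotopyCoeff Q α p).comp G)).curryLeft (A p.1 p.2) +
      alternatizeUncurryFin ((homotopyCoeff Q (contract A α) p).comp G) := by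
  have h := sub_pull_succ Q hα p
  have hG : G (A p.1 p.2) = Q p.2 := congrArg (fun B : E →L[ℝ] E => B p.2) hGA
  rw [homotopyCoeff_contract hA hα p hAQ hAG, alternatizeUncurryFin_add,
    curryLeft_alternatizeUncurryFin, ContinuousLinearMap.comp_apply, hG, add_assoc,
    sub_add_eq_add_sub, add_sub_assoc, add_sub_cancel_left, ← h, add_sub_cancel]

theorem homotopy_zero {A G Q : E →L[ℝ] E}
    {α : ℝ × E → E [⋀^Fin 0]→L[ℝ] F} (hα : ContDiff ℝ ∞ α) (p : ℝ × E) (hGA : G * A = Q) :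
    α p = pull (1 - Q) α p + homotopyCoeff Q α p (G (A p.2)) := by
  have hG : G (A p.2) = Q p.2 := congrArg (fun B : E →L[ℝ] E => B p.2) hGA
  rw [hG, ← sub_pull_zero Q hα p, add_sub_cancel]

end Homotopy

end CircleLoop

namespace CircleLoop

open ContinuousAlternatingMap Filter Topology

/-! ### The linear local model -/

section LocalModel

/-- A splitting, near `s = 0`, of a smooth family of operators `A s`. On the range of the
projection `Q` the operators `A s` are invertible with inverse `G s`, and on its kernel
`A s = s N s`, where `N s` is invertible on the range of the projection `P` with inverse `M s` and
zero on the kernel of `P`. The operator `X` is the generator of the family on the kernel of `Q`. -/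
structure LocalSplitting {E : Type} [NormedAddCommGroup E] [NormedSpace ℝ E]
    (A : ℝ → E →L[ℝ] E) (X : E →L[ℝ] E) where
  (Q P : E →L[ℝ] E)
  (G N M : ℝ → E →L[ℝ] E)
  contDiff_A : ContDiff ℝ ∞ A
  contDiff_G : ContDiff ℝ ∞ G
  contDiff_N : ContDiff ℝ ∞ N
  contDiff_M : ContDiff ℝ ∞ M
  Q_mul_Q : Q * Q = Q
  Q_mul_P : Q * P = 0
  P_mul_Q : P * Q = 0
  commute_A : ∀ s, Commute (A s) Q
  A_mul : ∀ s, A s * (1 - Q) = s • N s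
  N_mul_P : ∀ s, N s * P = N s
  P_mul_N : ∀ s, P * N s = N s
  N_zero : N 0 = -(X * (1 - Q))
  G_mul_Q : ∀ s, G s * Q = G s
  M_mul_P : ∀ s, M s * P = M s
  eventually_G : ∀ᶠ s in 𝓝 0, A s * G s = Q ∧ G s * A s = Q
  eventually_M : ∀ᶠ s in 𝓝 0, N s * M s = P ∧ M s * N s = P

variable {E F : Type} [NormedAddCommGroup E] [NormedSpace ℝ E] [NormedAddCommGroup F]
  [NormedSpace ℝ F] {k : ℕ} {A : ℝ → E →L[ℝ] E} {X : E →L[ℝ] E}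

theorem contract_pull {B : ℝ → E →L[ℝ] E} {C : E →L[ℝ] E} {p : ℝ × E} (h : Commute (B p.1) C)
    (α : ℝ × E → E [⋀^Fin (k + 1)]→L[ℝ] F) :
    contract B (pull C α) p = pull C (contract B α) p := by
  have e : C (B p.1 p.2) = B p.1 (C p.2) := congrArg (fun T : E →L[ℝ] E => T p.2) h.eq.symm
  simp only [contract, pull, curryLeft_compContinuousLinearMap, e]

theorem pull_pull {C : E →L[ℝ] E} (hC : C * C = C) (α : ℝ × E → E [⋀^Fin k]→L[ℝ] F) (p : ℝ × E) :
    pull C (pull C α) p = pull C α p := by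
  have e (v : E) : C (C v) = C v := congrArg (fun T : E →L[ℝ] E => T v) hC
  ext w
  simp only [pull, compContinuousLinearMap_apply, e, Function.comp_def]

theorem alternatizeUncurryFin_zero :
    alternatizeUncurryFin (0 : E →L[ℝ] E [⋀^Fin k]→L[ℝ] F) = 0 := by
  rw [← alternatizeUncurryFinCLM_apply, _root_.map_zero]

theorem homotopyCoeff_zero (Q : E →L[ℝ] E) (p : ℝ × E) :
    homotopyCoeff Q (fun _ => (0 : E [⋀^Fin k]→L[ℝ] F)) p = 0 := by
  simp [homotopyCoeff, homotopyIntegrand]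

theorem contDiff_clm_comp [FiniteDimensional ℝ E] {H : Type} [NormedAddCommGroup H]
    [NormedSpace ℝ H] {W : Type} [NormedAddCommGroup W] [NormedSpace ℝ W] {b : H → E →L[ℝ] W}
    {G : H → E →L[ℝ] E} (hb : ContDiff ℝ ∞ b) (hG : ContDiff ℝ ∞ G) :
    ContDiff ℝ ∞ fun p => (b p).comp (G p) :=
  contDiff_clm_apply_iff.2 fun _ => hb.clm_apply (hG.clm_apply contDiff_const)

theorem contDiff_alternatizeUncurryFin_comp [FiniteDimensional ℝ E]
    {b : ℝ × E → E →L[ℝ] E [⋀^Fin k]→L[ℝ] F} {G : ℝ → E →L[ℝ] E} (hb : ContDiff ℝ ∞ b)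
    (hG : ContDiff ℝ ∞ G) : ContDiff ℝ ∞ fun p => alternatizeUncurryFin ((b p).comp (G p.1)) :=
  contDiff_alternatizeUncurryFin.comp (contDiff_clm_comp hb (hG.comp contDiff_fst))

namespace LocalSplitting

section Projections

variable (S : LocalSplitting A X)

/-- The projection onto the kernel of `Q`. -/
def C : E →L[ℝ] E := 1 - S.Q

theorem Q_mul_N (s : ℝ) : S.Q * S.N s = 0 := by
  rw [← S.P_mul_N, ← mul_assoc, S.Q_mul_P, zero_mul]

theorem N_mul_Q (s : ℝ) : S.N s * S.Q = 0 := by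
  rw [← S.N_mul_P, mul_assoc, S.P_mul_Q, mul_zero]

theorem C_mul_C : S.C * S.C = S.C := by
  rw [C, mul_sub, sub_mul, sub_mul, S.Q_mul_Q]
  simp

theorem commute_A_C (s : ℝ) : Commute (A s) S.C :=
  (Commute.one_right _).sub_right (S.commute_A s)

theorem commute_N_C (s : ℝ) : Commute (S.N s) S.C :=
  (Commute.one_right _).sub_right ((S.N_mul_Q s).trans (S.Q_mul_N s).symm)

theorem commute_N_P (s : ℝ) : Commute (S.N s) S.P := (S.N_mul_P s).trans (S.P_mul_N s).symm

theorem A_apply (s : ℝ) (v : E) : A s (S.C v) = s • S.N s v :=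
  congrArg (fun T : E →L[ℝ] E => T v) (S.A_mul s)

theorem C_A_apply (s : ℝ) (v : E) : S.C (A s v) = s • S.N s v := by
  rw [← S.A_apply]
  exact congrArg (fun T : E →L[ℝ] E => T v) (S.commute_A_C s).eq.symm

theorem C_N_apply (s : ℝ) (v : E) : S.C (S.N s v) = S.N s v := by
  have : S.Q (S.N s v) = 0 := congrArg (fun T : E →L[ℝ] E => T v) (S.Q_mul_N s)
  simp [C, this]

theorem N_one_sub_P_apply (s : ℝ) (v : E) : S.N s ((1 - S.P) v) = 0 := by
  have : S.N s (S.P v) = S.N s v := congrArg (fun T : E →L[ℝ] E => T v) (S.N_mul_P s)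
  simp [this]

theorem M_mul_C (s : ℝ) : S.M s * S.C = S.M s := by
  rw [C, mul_sub, mul_one, ← S.M_mul_P, mul_assoc, S.P_mul_Q, mul_zero, sub_zero]

/-- After projection to the kernel of `Q` the field `A s v` becomes `s N s v`, so forms pulled back
along `C` only see `s N`. -/
theorem contract_pull_C (α : ℝ × E → E [⋀^Fin (k + 1)]→L[ℝ] F) (p : ℝ × E) :
    contract A (pull S.C α) p = p.1 • contract S.N (pull S.C α) p := by
  simp only [contract, pull, curryLeft_compContinuousLinearMap]
  rw [S.C_A_apply, S.C_N_apply, map_smul]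
  rfl

end Projections

/-! ### Solving the local equations for a split family. -/

variable [FiniteDimensional ℝ E] [CompleteSpace F]

/-- Smooth functions vanishing on the zeros of the field `(s, v) ↦ A s v` lie, near `s = 0`, in
the ideal generated by its components. -/
theorem exists_eq_apply_field (S : LocalSplitting A X)
    {α : ℝ × E → E [⋀^Fin 0]→L[ℝ] F} (hα : ContDiff ℝ ∞ α)
    (h0 : ∀ s v, A s v = 0 → α (s, v) = 0) :
    ∃ a : ℝ × E → E →L[ℝ] E [⋀^Fin 0]→L[ℝ] F, ContDiff ℝ ∞ a ∧
      ∀ᶠ s in 𝓝 (0 : ℝ), ∀ v, α (s, v) = a (s, v) (A s v) := by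
  obtain ⟨γ, hγ, e⟩ := exists_eq_smul_of_zero (contDiff_pull S.C hα) fun v => by
    rw [pull, h0]
    · rfl
    · simp [S.A_apply]
  -- On the kernel of `P` the operator `N` vanishes, so `A` has a zero at the projected point. For
  -- `s ≠ 0` the factor `s` can be cancelled, and continuity covers `s = 0`.
  have hγ0 : ∀ s v, pull (1 - S.P) γ (s, v) = 0 := by
    refine eq_zero_of_ne_zero (contDiff_pull _ hγ).continuous fun s hs v => ?_
    have h1 : γ (s, (1 - S.P) v) = 0 := by
      have h2 := e s ((1 - S.P) v)
      rw [pull, h0] at h2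
      · exact ((smul_eq_zero_iff_right hs).1 h2.symm)
      · rw [S.A_apply, S.N_one_sub_P_apply, smul_zero]
    rw [pull, h1]
    rfl
  -- The first summand accounts for `α` minus its pullback along `C`. The second writes that
  -- pullback `s γ` through `A`, because `s N v = C (A v)`.
  refine ⟨fun p => (homotopyCoeff S.Q α p).comp (S.G p.1) +
    (homotopyCoeff S.P γ p).comp (S.M p.1 * S.C), ?_, ?_⟩
  · refine (contDiff_clm_comp (contDiff_homotopyCoeff _ hα) (S.contDiff_G.comp contDiff_fst)).add
      (contDiff_clm_comp (contDiff_homotopyCoeff _ hγ) ?_)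
    exact contDiff_clm_comp (S.contDiff_M.comp contDiff_fst) contDiff_const
  · filter_upwards [S.eventually_G, S.eventually_M] with s hG hM v
    rw [homotopy_zero hα (s, v) hG.2]
    change pull S.C α (s, v) + _ = _
    rw [e, homotopy_zero hγ (s, v) hM.2, hγ0, zero_add, add_comm]
    simp [S.C_A_apply]

/-- A family of forms killed by the contraction with `N` that restricts to zero on the kernel of
`P` is a contraction with `N`. -/
theorem eventually_eq_contract_N (S : LocalSplitting A X)
    {γ : ℝ × E → E [⋀^Fin (k + 1)]→L[ℝ] F} (hγ : ContDiff ℝ ∞ γ)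
    (hγ0 : ∀ s v, pull (1 - S.P) γ (s, v) = 0) (hγN : ∀ s v, contract S.N γ (s, v) = 0) :
    ∀ᶠ s in 𝓝 (0 : ℝ), ∀ v, γ (s, v) =
      (alternatizeUncurryFin ((homotopyCoeff S.P γ (s, v)).comp (S.M s))).curryLeft (S.N s v) := by
  filter_upwards [S.eventually_M] with s hM v
  have h := homotopy_succ S.contDiff_N hγ (s, v) (S.commute_N_P s) hM.1 hM.2
  have h1 : contract S.N γ = fun _ => 0 := funext fun p => hγN p.1 p.2
  rw [hγ0, h1, homotopyCoeff_zero, ContinuousLinearMap.zero_comp, zero_add] at h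
  rw [h, alternatizeUncurryFin_zero, add_zero]

theorem eventually_eq_contract_N_zero (S : LocalSplitting A X)
    {γ : ℝ × E → E [⋀^Fin 0]→L[ℝ] F} (hγ : ContDiff ℝ ∞ γ)
    (hγ0 : ∀ s v, pull (1 - S.P) γ (s, v) = 0) :
    ∀ᶠ s in 𝓝 (0 : ℝ), ∀ v, γ (s, v) =
      (alternatizeUncurryFin ((homotopyCoeff S.P γ (s, v)).comp (S.M s))).curryLeft (S.N s v) := by
  filter_upwards [S.eventually_M] with s hM v
  rw [curryLeft_alternatizeUncurryFin_zero, homotopy_zero hγ (s, v) hM.2, hγ0, zero_add]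
  rfl

/-- A cycle that lies in the ideal generated by the components of the field `(s, v) ↦ A s v` and
their differentials is, near `s = 0`, a boundary. -/
theorem exists_eq_contract (S : LocalSplitting A X)
    {α : ℝ × E → E [⋀^Fin (k + 1)]→L[ℝ] F} (hα : ContDiff ℝ ∞ α)
    (hα0 : ∀ p, contract A α p = 0)
    {a : ℝ × E → E →L[ℝ] E [⋀^Fin (k + 1)]→L[ℝ] F} (ha : ContDiff ℝ ∞ a)
    {b : ℝ × E → E →L[ℝ] E [⋀^Fin k]→L[ℝ] F} (hb : ContDiff ℝ ∞ b)
    (e : ∀ s v, α (s, v) = a (s, v) (A s v) + alternatizeUncurryFin ((b (s, v)).comp (A s))) :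
    ∃ ζ : ℝ × E → E [⋀^Fin (k + 2)]→L[ℝ] F, ContDiff ℝ ∞ ζ ∧
      ∀ᶠ s in 𝓝 (0 : ℝ), ∀ v, α (s, v) = (ζ (s, v)).curryLeft (A s v) := by
  -- This is the pullback of `α` along `C` divided by `s`: in the given expression for `α`, each `A`
  -- turns into `s N` on the kernel of `Q`.
  let γ : ℝ × E → E [⋀^Fin (k + 1)]→L[ℝ] F := fun p =>
    (a (p.1, S.C p.2) (S.N p.1 p.2)).compContinuousLinearMap S.C +
      alternatizeUncurryFin
        (((compContinuousLinearMapCLM S.C).comp (b (p.1, S.C p.2))).comp (S.N p.1))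
  have hc : ContDiff ℝ ∞ fun p : ℝ × E => (p.1, S.C p.2) := by fun_prop
  have hγ : ContDiff ℝ ∞ γ := by
    refine (contDiff_compContinuousLinearMap
      ((ha.comp hc).clm_apply (contDiff_field S.contDiff_N)) contDiff_const).add
      (contDiff_alternatizeUncurryFin_comp (contDiff_clm_apply_iff.2 fun u => ?_) S.contDiff_N)
    exact contDiff_compContinuousLinearMap ((hb.comp hc).clm_apply contDiff_const) contDiff_const
  have hβ : ∀ s v, pull S.C α (s, v) = s • γ (s, v) := by
    intro s v
    have h1 : (A s).comp S.C = s • S.N s := S.A_mul s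
    have h2 : (compContinuousLinearMapCLM S.C).comp (((b (s, S.C v)).comp (A s)).comp S.C) =
        s • (((compContinuousLinearMapCLM S.C).comp (b (s, S.C v))).comp (S.N s)) := by
      rw [ContinuousLinearMap.comp_assoc, h1]
      ext u
      simp
    simp only [pull, γ, e]
    rw [S.A_apply, (a (s, S.C v)).map_smul, smul_add, ← alternatizeUncurryFin_smul, ← h2,
      ← compContinuousLinearMap_alternatizeUncurryFin]
    rfl
  -- The pullback of a cycle along `C` is a cycle, which reads `s² i_N γ = 0`.
  have hγN : ∀ s v, contract S.N γ (s, v) = 0 := by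
    refine eq_zero_of_ne_zero (contDiff_contract S.contDiff_N hγ).continuous fun s hs v => ?_
    have h1 : contract A (pull S.C α) (s, v) = 0 := by
      rw [contract_pull (S.commute_A_C s), pull, hα0]
      rfl
    have h2 : s • (pull S.C α (s, v)).curryLeft (S.N s v) = 0 := by
      rw [← h1]
      exact (S.contract_pull_C α (s, v)).symm
    rw [hβ, curryLeft_smul] at h2
    exact (smul_eq_zero_iff_right hs).1 ((smul_eq_zero_iff_right hs).1 h2)
  have hγ0 : ∀ s v, pull (1 - S.P) γ (s, v) = 0 := by
    intro s v
    have h1 : (S.N s).comp (1 - S.P) = 0 := by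
      ext u
      exact S.N_one_sub_P_apply s u
    simp only [pull, γ]
    rw [S.N_one_sub_P_apply, _root_.map_zero]
    have h2 : ∀ B : E →L[ℝ] E [⋀^Fin k]→L[ℝ] F, (alternatizeUncurryFin
        (B.comp (S.N s))).compContinuousLinearMap (1 - S.P) = 0 := by
      intro B
      rw [compContinuousLinearMap_alternatizeUncurryFin, ContinuousLinearMap.comp_assoc, h1,
        ContinuousLinearMap.comp_zero, ContinuousLinearMap.comp_zero,
        alternatizeUncurryFin_zero]
    have h3 : ∀ B B' : E [⋀^Fin (k + 1)]→L[ℝ] F, (B + B').compContinuousLinearMap (1 - S.P) =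
      B.compContinuousLinearMap (1 - S.P) + B'.compContinuousLinearMap (1 - S.P) := fun _ _ => rfl
    rw [h3, h2, add_zero]
    rfl
  let ζ : ℝ × E → E [⋀^Fin (k + 2)]→L[ℝ] F := fun p =>
    alternatizeUncurryFin ((homotopyCoeff S.P γ p).comp (S.M p.1))
  have hζ : ContDiff ℝ ∞ ζ :=
    contDiff_alternatizeUncurryFin_comp (contDiff_homotopyCoeff _ hγ) S.contDiff_M
  -- The Koszul homotopy along `Q` is a primitive of `α` minus its pullback along `C`. The rest is
  -- `s γ = s i_N ζ`, with primitive the pullback of `ζ`.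
  refine ⟨fun p => alternatizeUncurryFin ((homotopyCoeff S.Q α p).comp (S.G p.1)) + pull S.C ζ p,
    (contDiff_alternatizeUncurryFin_comp (contDiff_homotopyCoeff _ hα) S.contDiff_G).add
      (contDiff_pull S.C hζ), ?_⟩
  filter_upwards [S.eventually_G, S.eventually_eq_contract_N hγ hγ0 hγN] with s hG hN v
  have h := homotopy_succ S.contDiff_A hα (s, v) (S.commute_A s) hG.1 hG.2
  have h1 : contract A α = fun _ => 0 := funext hα0
  rw [h1, homotopyCoeff_zero, ContinuousLinearMap.zero_comp,
    alternatizeUncurryFin_zero, add_zero] at h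
  rw [h, curryLeft_add]
  refine (add_comm _ _).trans (congrArg₂ (· + ·) rfl ?_)
  change pull S.C α (s, v) = (pull S.C ζ (s, v)).curryLeft (A s v)
  have h2 : (pull S.C ζ (s, v)).curryLeft (A s v) = s • pull S.C (contract S.N ζ) (s, v) := by
    rw [← contract_pull (S.commute_N_C s)]
    exact S.contract_pull_C ζ (s, v)
  have h3 : contract S.N ζ (s, S.C v) = γ (s, S.C v) := (hN (S.C v)).symm
  have h4 : s • pull S.C (contract S.N ζ) (s, v) = pull S.C (pull S.C α) (s, v) := by
    simp only [pull] at hβ ⊢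
    rw [h3, hβ]
    rfl
  rw [h2, h4, pull_pull S.C_mul_C]

/-- If `η = i_N ζ`, then `α - s ζ` is killed by `i_N` on the kernel of `Q`, and its pullback along
`C` is the cycle. The form `η` enters only through this primitive, so that degree zero, where no
cycle condition on `η` is available, is covered as well. -/
theorem exists_eq_cycle_add_aux (S : LocalSplitting A X)
    {α : ℝ × E → E [⋀^Fin (k + 1)]→L[ℝ] F} (hα : ContDiff ℝ ∞ α)
    {η : ℝ × E → E [⋀^Fin k]→L[ℝ] F}
    (e : ∀ s v, contract S.N (pull S.C α) (s, v) = s • η (s, v))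
    {c : ℝ × E → E →L[ℝ] E [⋀^Fin k]→L[ℝ] F} (hc : ContDiff ℝ ∞ c)
    (hη : ∀ᶠ s in 𝓝 (0 : ℝ), ∀ v, η (s, v) =
      (alternatizeUncurryFin ((c (s, v)).comp (S.M s))).curryLeft (S.N s v)) :
    ∃ z : ℝ × E → E [⋀^Fin (k + 1)]→L[ℝ] F, ContDiff ℝ ∞ z ∧
      ∃ a : ℝ × E → E →L[ℝ] E [⋀^Fin (k + 1)]→L[ℝ] F, ContDiff ℝ ∞ a ∧
      ∃ b : ℝ × E → E →L[ℝ] E [⋀^Fin k]→L[ℝ] F, ContDiff ℝ ∞ b ∧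
      ∀ᶠ s in 𝓝 (0 : ℝ), ∀ v, (z (s, v)).curryLeft (A s v) = 0 ∧
        α (s, v) = z (s, v) + (a (s, v) (A s v) +
          alternatizeUncurryFin ((b (s, v)).comp (A s))) := by
  let ζ : ℝ × E → E [⋀^Fin (k + 1)]→L[ℝ] F := fun p =>
    alternatizeUncurryFin ((c p).comp (S.M p.1))
  have hζ : ContDiff ℝ ∞ ζ := contDiff_alternatizeUncurryFin_comp hc S.contDiff_M
  let z' : ℝ × E → E [⋀^Fin (k + 1)]→L[ℝ] F := fun p => pull S.C α p - p.1 • ζ p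
  have hz' : ContDiff ℝ ∞ z' := (contDiff_pull S.C hα).sub (contDiff_fst.smul hζ)
  have hcc : ContDiff ℝ ∞ fun p : ℝ × E => (p.1, S.C p.2) := by fun_prop
  have hM := S.contDiff_M.comp (contDiff_fst (𝕜 := ℝ) (E := ℝ) (F := E))
  have hG := S.contDiff_G.comp (contDiff_fst (𝕜 := ℝ) (E := ℝ) (F := E))
  refine ⟨pull S.C z', contDiff_pull S.C hz',
    fun p => (alternatizeUncurryFin ((homotopyCoeff S.Q α p).comp (S.G p.1))).curryLeft, ?_,
    -- Both extra factors serve to make `A` appear on the right: `G G A = G` for the homotopy term,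
    -- and `M M C A = s M` for the subtracted form `s ζ`.
    fun p => (homotopyCoeff S.Q (contract A α) p).comp (S.G p.1 * S.G p.1) +
      ((compContinuousLinearMapCLM S.C).comp (c (p.1, S.C p.2))).comp (S.M p.1 * S.M p.1 * S.C), ?_, ?_⟩
  · exact contDiff_clm_apply_iff.2 fun u => ContDiff.curryLeft_apply
      (contDiff_alternatizeUncurryFin_comp (contDiff_homotopyCoeff _ hα) S.contDiff_G)
      contDiff_const
  · refine (contDiff_clm_comp (contDiff_homotopyCoeff _ (contDiff_contract S.contDiff_A hα))
      (contDiff_clm_comp hG hG)).add (contDiff_clm_comp (contDiff_clm_apply_iff.2 fun u => ?_)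
        (contDiff_clm_comp (contDiff_clm_comp hM hM) contDiff_const))
    exact contDiff_compContinuousLinearMap ((hc.comp hcc).clm_apply contDiff_const) contDiff_const
  · filter_upwards [S.eventually_G, S.eventually_M, hη] with s hG hM hη v
    constructor
    · have h1 : contract A (pull S.C z') (s, v) = s • pull S.C (contract S.N z') (s, v) := by
        rw [← contract_pull (S.commute_N_C s)]
        exact S.contract_pull_C z' (s, v)
      have h2 : contract S.N z' (s, S.C v) = 0 := by
        have h3 : contract S.N z' (s, S.C v) = contract S.N (pull S.C α) (s, S.C v) -
          s • (ζ (s, S.C v)).curryLeft (S.N s (S.C v)) := rfl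
        rw [h3, e, hη, sub_self]
      have h4 : contract A (pull S.C z') (s, v) = 0 := by
        rw [h1, pull, h2]
        exact smul_zero s
      exact h4
    · have h := homotopy_succ S.contDiff_A hα (s, v) (S.commute_A s) hG.1 hG.2
      have h1 : pull S.C z' (s, v) = pull S.C α (s, v) - s • pull S.C ζ (s, v) := by
        rw [← pull_pull S.C_mul_C α]
        rfl
      have h2 : S.G s * S.G s * A s = S.G s := by rw [mul_assoc, hG.2, S.G_mul_Q]
      have h3 : S.M s * S.M s * S.C * A s = s • S.M s := by
        rw [mul_assoc _ S.C, ← (S.commute_A_C s).eq, show A s * S.C = s • S.N s from S.A_mul s,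
          mul_smul_comm, mul_assoc,
          hM.2, S.M_mul_P]
      have h5 : s • pull S.C ζ (s, v) = alternatizeUncurryFin
          ((((compContinuousLinearMapCLM S.C).comp (c (s, S.C v))).comp
            (S.M s * S.M s * S.C)).comp (A s)) := by
        have h6 : S.M s * S.M s * S.C * A s = s • (S.M s * S.C) := by rw [h3, S.M_mul_C]
        rw [ContinuousLinearMap.comp_assoc]
        change _ = alternatizeUncurryFin (((compContinuousLinearMapCLM S.C).comp
          (c (s, S.C v))).comp (S.M s * S.M s * S.C * A s))
        rw [h6]
        simp only [pull, ζ]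
        rw [compContinuousLinearMap_alternatizeUncurryFin, ← alternatizeUncurryFin_smul]
        congr 1
        ext u
        simp
      rw [h1, ContinuousLinearMap.add_comp, alternatizeUncurryFin_add, ← h5,
        ContinuousLinearMap.comp_assoc]
      change _ = _ + (_ + (alternatizeUncurryFin ((homotopyCoeff S.Q (contract A α) (s, v)).comp
        (S.G s * S.G s * A s)) + _))
      rw [h2, h, show pull (1 - S.Q) α = pull S.C α from rfl]
      abel

/-- A form that is killed, for `s = 0`, by contraction with `X` at the zeros of the field
`(s, v) ↦ A s v` is, near `s = 0`, the sum of a cycle and an element of the ideal generated by the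
components of the field and their differentials. -/
theorem exists_eq_cycle_add (S : LocalSplitting A X) {α : ℝ × E → E [⋀^Fin (k + 1)]→L[ℝ] F}
    (hα : ContDiff ℝ ∞ α) (hX : ∀ v, A 0 v = 0 → (α (0, v)).curryLeft (X v) = 0) :
    ∃ z : ℝ × E → E [⋀^Fin (k + 1)]→L[ℝ] F, ContDiff ℝ ∞ z ∧
      ∃ a : ℝ × E → E →L[ℝ] E [⋀^Fin (k + 1)]→L[ℝ] F, ContDiff ℝ ∞ a ∧
      ∃ b : ℝ × E → E →L[ℝ] E [⋀^Fin k]→L[ℝ] F, ContDiff ℝ ∞ b ∧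
      ∀ᶠ s in 𝓝 (0 : ℝ), ∀ v, (z (s, v)).curryLeft (A s v) = 0 ∧
        α (s, v) = z (s, v) + (a (s, v) (A s v) +
          alternatizeUncurryFin ((b (s, v)).comp (A s))) := by
  have hN0 : ∀ v, S.N 0 v = -X (S.C v) := fun v =>
    congrArg (fun T : E →L[ℝ] E => T v) S.N_zero
  have hβ := contDiff_contract S.contDiff_N (contDiff_pull S.C hα)
  -- At `s = 0` the contraction is with `-X (C v)`, and `C v` is a zero of `A 0`, so the hypothesis
  -- applies.
  obtain ⟨η, hη, e⟩ := exists_eq_smul_of_zero hβ fun v => by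
    rw [contract, pull, curryLeft_compContinuousLinearMap, S.C_N_apply]
    simp only [hN0]
    rw [_root_.map_neg, hX]
    · simp
      rfl
    · simp [S.A_apply]
  have hη0 : ∀ s v, pull (1 - S.P) η (s, v) = 0 := by
    refine eq_zero_of_ne_zero (contDiff_pull _ hη).continuous fun s hs v => ?_
    have h1 : η (s, (1 - S.P) v) = 0 := by
      have h2 := e s ((1 - S.P) v)
      rw [contract] at h2
      simp only [S.N_one_sub_P_apply, _root_.map_zero] at h2
      exact ((smul_eq_zero_iff_right hs).1 h2.symm)
    rw [pull, h1]
    rfl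
  refine S.exists_eq_cycle_add_aux hα e (contDiff_homotopyCoeff S.P hη) ?_
  cases k with
  | zero => exact S.eventually_eq_contract_N_zero hη hη0
  | succ k =>
    refine S.eventually_eq_contract_N hη hη0 ?_
    refine eq_zero_of_ne_zero (contDiff_contract S.contDiff_N hη).continuous fun s hs v => ?_
    have h1 := curryLeft_same (pull S.C α (s, v)) (S.N s v)
    have h2 : (pull S.C α (s, v)).curryLeft (S.N s v) = s • η (s, v) := e s v
    rw [h2, curryLeft_smul] at h1
    exact (smul_eq_zero_iff_right hs).1 h1

end LocalSplitting

end LocalModel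

end CircleLoop

namespace CircleLoop

open Filter Topology

/-! ### The local splitting of a circle action -/

section Splitting

variable {E F : Type} [NormedAddCommGroup E] [NormedSpace ℝ E] [FiniteDimensional ℝ E]
  [NormedAddCommGroup F] [NormedSpace ℝ F]

theorem exists_contDiff_cutoff {U : Set E} {x : E} (hU : U ∈ 𝓝 x) :
    ∃ χ : E → ℝ, ContDiff ℝ ∞ χ ∧ (∀ᶠ y in 𝓝 x, χ y = 1) ∧ tsupport χ ⊆ U := by
  obtain ⟨ε, hε, h⟩ := Metric.nhds_basis_closedBall.mem_iff.1 hU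
  let χ : ContDiffBump x := ⟨ε / 2, ε, half_pos hε, half_lt_self hε⟩
  exact ⟨χ, χ.contDiff, χ.eventuallyEq_one, χ.tsupport_eq.trans_subset h⟩

theorem exists_contDiff_eventuallyEq {f : E → F} {x : E}
    (hf : ∀ᶠ y in 𝓝 x, ContDiffAt ℝ ∞ f y) : ∃ g : E → F, ContDiff ℝ ∞ g ∧ g =ᶠ[𝓝 x] f := by
  obtain ⟨χ, hχ, h1, hs⟩ := exists_contDiff_cutoff hf
  refine ⟨fun y => χ y • f y, contDiff_iff_contDiffAt.2 fun y => ?_, h1.mono fun y hy => ?_⟩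
  · by_cases hy : y ∈ tsupport χ
    · exact hχ.contDiffAt.smul (hs hy)
    · refine contDiffAt_const (c := (0 : F)) |>.congr_of_eventuallyEq ?_
      filter_upwards [(isClosed_tsupport χ).isOpen_compl.mem_nhds hy] with z hz
      rw [image_eq_zero_of_notMem_tsupport hz, zero_smul]
  · simp [hy]

/-- An endomorphism whose kernel and range meet only in zero has a projection onto its range along
its kernel. -/
theorem exists_projection_range (T : E →L[ℝ] E) (hT : ∀ v, T (T v) = 0 → T v = 0) :
    ∃ Q : E →L[ℝ] E, Q * Q = Q ∧ T * (1 - Q) = 0 ∧ (∀ v, T v = 0 → Q v = 0) ∧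
      ∀ B : E →L[ℝ] E, Commute B T → Commute B Q := by
  let T' : E →ₗ[ℝ] E := T
  have hd : Disjoint (LinearMap.range T') (LinearMap.ker T') := by
    rw [Submodule.disjoint_def]
    rintro _ ⟨v, rfl⟩ hv
    exact hT v hv
  have hc : IsCompl (LinearMap.range T') (LinearMap.ker T') :=
    (Submodule.isCompl_iff_disjoint _ _ (LinearMap.finrank_range_add_finrank_ker T').ge).2 hd
  let Q' := (LinearMap.range T').projection (LinearMap.ker T') hc
  let Q : E →L[ℝ] E := LinearMap.toContinuousLinearMap Q'
  have hQr (v : E) : Q (T v) = T v := Submodule.projection_apply_of_mem_left hc ⟨v, rfl⟩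
  have hQm (v : E) : ∃ u, T u = Q v := Submodule.projection_apply_mem hc v
  have hQk (v : E) (hv : T v = 0) : Q v = 0 := Submodule.projection_apply_of_mem_right hc hv
  have hQ (v : E) : Q (Q v) = Q v := by
    obtain ⟨u, hu⟩ := hQm v
    rw [← hu, hQr]
  have hTQ (v : E) : T (v - Q v) = 0 := by
    have : Q' (v - Q v) = 0 := by
      rw [map_sub]
      exact sub_eq_zero.2 (hQ v).symm
    exact (Submodule.projection_apply_eq_zero_iff hc).1 this
  refine ⟨Q, ContinuousLinearMap.ext hQ, ContinuousLinearMap.ext hTQ, hQk, fun B hB => ?_⟩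
  have hBT (v : E) : B (T v) = T (B v) := congrArg (fun S : E →L[ℝ] E => S v) hB.eq
  refine ContinuousLinearMap.ext fun v => ?_
  change B (Q v) = Q (B v)
  have h1 : Q (B (v - Q v)) = 0 := hQk _ (by rw [← hBT, hTQ, map_zero])
  obtain ⟨u, hu⟩ := hQm v
  have h2 : Q (B (Q v)) = B (Q v) := by rw [← hu, hBT, hQr]
  rw [map_sub, map_sub, h2] at h1
  exact (sub_eq_zero.1 h1).symm

/-- The operator is `T` on the range of `Q` and the identity on its kernel; it is injective, hence
bijective in finite dimension. -/
theorem isUnit_mul_add_one_sub {T Q : E →L[ℝ] E} (hQ : Q * Q = Q) (hTQ : Commute T Q)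
    (h : ∀ v, T (Q v) = 0 → Q v = 0) : IsUnit (T * Q + (1 - Q)) := by
  have hQ' (v : E) : Q (Q v) = Q v := congrArg (fun S : E →L[ℝ] E => S v) hQ
  have hTQ' (v : E) : T (Q v) = Q (T v) := congrArg (fun S : E →L[ℝ] E => S v) hTQ.eq
  have hinj : Function.Injective (T * Q + (1 - Q) : E →L[ℝ] E) := by
    refine (injective_iff_map_eq_zero _).2 fun v hv => ?_
    have hv' : T (Q v) + (v - Q v) = 0 := hv
    have h1 := congrArg Q hv'
    rw [map_add, map_sub, hQ', sub_self, add_zero, ← hTQ', hQ', map_zero] at h1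
    rw [h1, h v h1] at hv'
    simpa using hv'
  exact ContinuousLinearMap.isUnit_iff_bijective.2
    ⟨hinj, (LinearMap.injective_iff_surjective (f := (T * Q + (1 - Q) : E →ₗ[ℝ] E))).1 hinj⟩

/-- Completing `B s` by the identity on the kernel of `Q` gives a unit for small `s`. Its inverse is
smooth near `0`, is replaced by a global smooth family with the same germ, and is then restricted to
the range of `Q`. -/
theorem exists_inverse_along {B : ℝ → E →L[ℝ] E} (hB : ContDiff ℝ ∞ B) {Q : E →L[ℝ] E}
    (hQ : Q * Q = Q) (hBQ : ∀ s, Commute (B s) Q) (h : ∀ v, B 0 (Q v) = 0 → Q v = 0) :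
    ∃ G : ℝ → E →L[ℝ] E, ContDiff ℝ ∞ G ∧ (∀ s, G s * Q = G s) ∧
      ∀ᶠ s in 𝓝 (0 : ℝ), B s * G s = Q ∧ G s * B s = Q := by
  let D : ℝ → E →L[ℝ] E := fun s => B s * Q + (1 - Q)
  have hD : ContDiff ℝ ∞ D := (hB.clm_comp contDiff_const).add contDiff_const
  have hu : ∀ᶠ s in 𝓝 (0 : ℝ), IsUnit (D s) :=
    hD.continuous.continuousAt.eventually_mem
      (Units.isOpen.mem_nhds (isUnit_mul_add_one_sub hQ (hBQ 0) h))
  have hs : ∀ᶠ s in 𝓝 (0 : ℝ), ContDiffAt ℝ ∞ (fun s => Ring.inverse (D s)) s := by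
    filter_upwards [hu] with s ⟨u, hu⟩
    have h1 : ContDiffAt ℝ ∞ Ring.inverse (D s) := hu ▸ contDiffAt_ringInverse ℝ u
    exact h1.comp s hD.contDiffAt
  obtain ⟨G, hG, e⟩ := exists_contDiff_eventuallyEq hs
  refine ⟨fun s => G s * Q, hG.clm_comp contDiff_const, fun s => by rw [mul_assoc, hQ], ?_⟩
  filter_upwards [hu, e] with s hu e
  have hDQ : D s * Q = B s * Q := by
    simp only [D, add_mul, sub_mul, mul_assoc, hQ, one_mul, sub_self, add_zero]
  have hc1 : Commute (B s) (D s) :=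
    ((Commute.refl _).mul_right (hBQ s)).add_right ((Commute.one_right _).sub_right (hBQ s))
  have hi : G s * D s = 1 := by rw [e, Ring.inverse_mul_cancel _ hu]
  have hi' : D s * G s = 1 := by rw [e, Ring.mul_inverse_cancel _ hu]
  have hc3 : Commute (B s) (G s) := by
    calc B s * G s = G s * (D s * B s) * G s := by rw [← mul_assoc, hi, one_mul]
      _ = G s * B s * (D s * G s) := by rw [← hc1.eq]; simp only [mul_assoc]
      _ = G s * B s := by rw [hi', mul_one]
  have h1 : G s * Q * B s = Q := by
    rw [mul_assoc, ← (hBQ s).eq, ← hDQ, ← mul_assoc, hi, one_mul]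
  have h2 : B s * (G s * Q) = Q := by
    rw [← mul_assoc, hc3.eq, mul_assoc, ← hDQ, ← mul_assoc, hi, one_mul]
  exact ⟨h2, h1⟩

end Splitting

/-! ### Circle actions -/

section CircleAction

variable {E : Type} [NormedAddCommGroup E] [NormedSpace ℝ E] (ρ : Circle →* (E →L[ℝ] E))

/-- The generator of a circle action. -/
def generator : E →L[ℝ] E := deriv (fun t : ℝ => ρ (Circle.exp t)) 0

/-- The field `s ↦ 1 - ρ (g₀ exp (i s))`. -/
def fieldNear (g₀ : Circle) (s : ℝ) : E →L[ℝ] E := 1 - ρ (g₀ * Circle.exp s)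

variable {ρ} (hρ : ContMDiff (𝓡 1) 𝓘(ℝ, E →L[ℝ] E) ∞ ρ)

include hρ

theorem contDiff_exp (g₀ : Circle) : ContDiff ℝ ∞ fun s : ℝ => ρ (g₀ * Circle.exp s) := by
  have h : ContMDiff 𝓘(ℝ, ℝ) (𝓡 1) ∞ fun s : ℝ => g₀ * Circle.exp s :=
    contMDiff_const.mul contMDiff_circleExp
  exact (hρ.comp h).contDiff

theorem contDiff_exp_one : ContDiff ℝ ∞ fun s : ℝ => ρ (Circle.exp s) := by
  simpa using contDiff_exp hρ 1

theorem hasDerivAt_exp_zero : HasDerivAt (fun t : ℝ => ρ (Circle.exp t)) (generator ρ) 0 :=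
  ((contDiff_exp_one hρ).differentiable (by simp) 0).hasDerivAt

theorem commute_generator {B : E →L[ℝ] E} (hB : ∀ s : ℝ, Commute B (ρ (Circle.exp s))) :
    Commute B (generator ρ) := by
  have h1 := (hasDerivAt_exp_zero hρ).const_mul B
  have h2 := (hasDerivAt_exp_zero hρ).mul_const B
  have h3 : (fun t : ℝ => B * ρ (Circle.exp t)) = fun t : ℝ => ρ (Circle.exp t) * B :=
    funext fun t => (hB t).eq
  rw [h3] at h1
  exact h1.unique h2

omit hρ in
theorem commute_rho (g h : Circle) : Commute (ρ g) (ρ h) := by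
  rw [Commute, SemiconjBy, ← map_mul, ← map_mul, mul_comm]

theorem hasDerivAt_exp (s : ℝ) :
    HasDerivAt (fun t : ℝ => ρ (Circle.exp t)) (ρ (Circle.exp s) * generator ρ) s := by
  have h1 : HasDerivAt (fun t : ℝ => ρ (Circle.exp (t - s))) (generator ρ) s := by
    have h2 : HasDerivAt (fun t : ℝ => ρ (Circle.exp t)) (generator ρ) (s - s) := by
      rw [sub_self]
      exact hasDerivAt_exp_zero hρ
    exact h2.comp_sub_const s s
  refine (h1.const_mul (ρ (Circle.exp s))).congr_of_eventuallyEq (Eventually.of_forall fun t => ?_)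
  simp only
  rw [← map_mul, ← Circle.exp_add, add_sub_cancel]

theorem exp_apply_of_generator_eq_zero {w : E} (hw : generator ρ w = 0) (s : ℝ) :
    ρ (Circle.exp s) w = w := by
  have h (t : ℝ) : HasDerivAt (fun t : ℝ => ρ (Circle.exp t) w) 0 t := by
    have h1 := (hasDerivAt_exp hρ t).clm_apply (hasDerivAt_const t w)
    simpa [hw] using h1
  have := is_const_of_deriv_eq_zero (fun t => (h t).differentiableAt) (fun t => (h t).deriv) s 0
  simpa using this

/-- If `w = X v` is killed by `X`, then `ρ (exp (i t)) v = v + t w`, and periodicity in `t` forces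
`w = 0`. -/
theorem generator_semisimple (v : E) (hv : generator ρ (generator ρ v) = 0) :
    generator ρ v = 0 := by
  set w := generator ρ v with hw
  have h (t : ℝ) : HasDerivAt (fun t : ℝ => ρ (Circle.exp t) v - t • w) 0 t := by
    have h1 := (hasDerivAt_exp hρ t).clm_apply (hasDerivAt_const t v)
    have h2 := h1.sub ((hasDerivAt_id t).smul_const w)
    simpa [← hw, exp_apply_of_generator_eq_zero hρ hv] using! h2
  have := is_const_of_deriv_eq_zero (fun t => (h t).differentiableAt) (fun t => (h t).deriv)
    (2 * Real.pi) 0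
  simpa [Real.pi_ne_zero] using this

/-- If `w = (1 - ρ g) v` is fixed by `ρ g`, then `ρ (g ^ n) v = v - n w`. Orbits of the compact
circle are bounded, so `w = 0`. -/
theorem one_sub_semisimple (g : Circle) (v : E) (hv : (1 - ρ g) ((1 - ρ g) v) = 0) :
    (1 - ρ g) v = 0 := by
  set w := (1 - ρ g) v with hw
  have hgw : ρ g w = w := (sub_eq_zero.1 hv).symm
  have hgv : ρ g v = v - w := by simp [hw]
  have hn (n : ℕ) : ρ (g ^ n) v = v - (n : ℝ) • w := by
    induction n with
    | zero => simp
    | succ n ih =>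
      have : ρ (g ^ (n + 1)) v = ρ g (ρ (g ^ n) v) := by rw [pow_succ', map_mul]; rfl
      rw [this, ih, map_sub, map_smul, hgw, hgv]
      push_cast
      module
  obtain ⟨C, hC⟩ := isCompact_univ.exists_bound_of_continuousOn
    ((hρ.continuous.clm_apply continuous_const (g := fun _ => v)).continuousOn (s := Set.univ))
  by_contra hw0
  have hpos := norm_pos_iff.2 hw0
  obtain ⟨n, hn'⟩ := exists_nat_gt ((‖v‖ + C) / ‖w‖)
  rw [div_lt_iff₀ hpos] at hn'
  have h1 : (n : ℝ) • w = v - ρ (g ^ n) v := by rw [hn, sub_sub_cancel]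
  have h2 : (n : ℝ) * ‖w‖ ≤ ‖v‖ + C := by
    calc (n : ℝ) * ‖w‖ = ‖(n : ℝ) • w‖ := by rw [norm_smul]; simp
      _ ≤ ‖v‖ + ‖ρ (g ^ n) v‖ := by rw [h1]; exact norm_sub_le _ _
      _ ≤ ‖v‖ + C := by gcongr; exact hC _ trivial
  exact absurd h2 (not_le.2 hn')

/-- Here `Q` projects onto the range of `1 - ρ g₀`, `R` onto the range of `X`, and `P = R (1 - Q)`.
All operators involved commute because the circle is abelian. -/
theorem nonempty_localSplitting [FiniteDimensional ℝ E] (g₀ : Circle) :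
    Nonempty (LocalSplitting (fieldNear ρ g₀) (generator ρ)) := by
  set X := generator ρ with hX
  have h0 : fieldNear ρ g₀ 0 = 1 - ρ g₀ := by simp [fieldNear]
  have hA : ContDiff ℝ ∞ (fieldNear ρ g₀) := contDiff_const.sub (contDiff_exp hρ g₀)
  obtain ⟨Q, hQ, hTQ, hQk, hQc⟩ := exists_projection_range (1 - ρ g₀) (one_sub_semisimple hρ g₀)
  obtain ⟨R, hR, hXR, hRk, hRc⟩ := exists_projection_range X (generator_semisimple hρ)
  have hρX (g : Circle) : Commute (ρ g) X := commute_generator hρ fun s => commute_rho _ _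
  have hρQ (g : Circle) : Commute (ρ g) Q :=
    hQc _ ((Commute.one_right _).sub_right (commute_rho _ _))
  have hρR (g : Circle) : Commute (ρ g) R := hRc _ (hρX g)
  have hXQ : Commute X Q := hQc _ ((Commute.one_right _).sub_right (hρX g₀).symm)
  have hXR' : Commute X R := hRc _ (Commute.refl _)
  have hQR : Commute Q R := hRc _ hXQ.symm
  -- the quotient of `1 - exp (s X)` by `s`
  obtain ⟨n', hn', e'⟩ := exists_eq_smul_of_zero (H := ℝ) (F := E →L[ℝ] E)
    (f := fun p => 1 - ρ (Circle.exp p.1))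
    (contDiff_const.sub ((contDiff_exp_one hρ).comp contDiff_fst)) fun v => by simp
  let n : ℝ → E →L[ℝ] E := fun s => n' (s, 0)
  have hn : ContDiff ℝ ∞ n := hn'.comp (by fun_prop : ContDiff ℝ ∞ fun s : ℝ => (s, (0 : ℝ)))
  have e (s : ℝ) : 1 - ρ (Circle.exp s) = s • n s := e' s 0
  have hn0 : n 0 = -X := by
    have h1 : HasDerivAt (fun s : ℝ => 1 - ρ (Circle.exp s)) (-X) 0 :=
      (hasDerivAt_exp_zero hρ).const_sub 1
    have h2 : HasDerivAt (fun s : ℝ => s • n s) (n 0) 0 := by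
      have := (hasDerivAt_id (0 : ℝ)).smul ((hn.differentiable (by simp) 0).hasDerivAt)
      simpa using! this
    have h3 : (fun s : ℝ => 1 - ρ (Circle.exp s)) = fun s : ℝ => s • n s := funext e
    rw [h3] at h1
    exact h2.unique h1
  have hns (s : ℝ) (hs : s ≠ 0) : n s = s⁻¹ • (1 - ρ (Circle.exp s)) := by
    rw [e, smul_smul, inv_mul_cancel₀ hs, one_smul]
  have hnc (B : E →L[ℝ] E) (hB : ∀ g, Commute (ρ g) B) (s : ℝ) : Commute (n s) B := by
    by_cases hs : s = 0
    · rw [hs, hn0]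
      exact (commute_generator hρ fun s => (hB _).symm).symm.neg_left
    · rw [hns s hs]
      exact (((Commute.one_left _).sub_left (hB _))).smul_left _
  have hnR (s : ℝ) : n s * R = n s := by
    have h : n s * (1 - R) = 0 := by
      by_cases hs : s = 0
      · rw [hs, hn0, neg_mul, hXR, neg_zero]
      · ext v
        have h1 : X ((1 - R) v) = 0 := congrArg (fun S : E →L[ℝ] E => S v) hXR
        have h2 := exp_apply_of_generator_eq_zero hρ h1 s
        change n s ((1 - R) v) = 0
        rw [hns s hs]
        change s⁻¹ • ((1 - R) v - ρ (Circle.exp s) ((1 - R) v)) = 0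
        rw [h2, sub_self, smul_zero]
    rw [mul_sub, mul_one, sub_eq_zero] at h
    exact h.symm
  let C : E →L[ℝ] E := 1 - Q
  have hC : C * C = C := by simp [C, mul_sub, sub_mul, hQ]
  have hQC : Q * C = 0 := by simp [C, mul_sub, hQ]
  have hCQ : C * Q = 0 := by simp [C, sub_mul, hQ]
  have hρC (g : Circle) : Commute (ρ g) C := (Commute.one_right _).sub_right (hρQ g)
  have hRC : Commute R C := (Commute.one_right _).sub_right hQR.symm
  have hXC : Commute X C := (Commute.one_right _).sub_right hXQ
  let P : E →L[ℝ] E := R * C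
  have hP : P * P = P := by
    simp only [P]
    rw [hRC.symm.mul_mul_mul_comm, hR, hC]
  -- On the kernel of `Q` the element `g₀` acts trivially, so there `A s` is `1 - ρ (exp (i s))`,
  -- which is divisible by `s`.
  have hρC0 : ρ g₀ * C = C := by
    have h : (1 - ρ g₀) * C = 0 := hTQ
    rw [sub_mul, one_mul, sub_eq_zero] at h
    exact h.symm
  have hAC (s : ℝ) : fieldNear ρ g₀ s * C = s • (n s * C) := by
    rw [← smul_mul_assoc, ← e, fieldNear, map_mul, sub_mul, sub_mul, (commute_rho _ _).eq,
      mul_assoc, hρC0]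
  have hnC (s : ℝ) : Commute (n s) C := hnc C hρC s
  have hnR' (s : ℝ) : Commute (n s) R := hnc R hρR s
  have hN : ContDiff ℝ ∞ fun s => n s * C := hn.clm_comp contDiff_const
  have hNP (s : ℝ) : n s * C * P = n s * C := by
    simp only [P]
    rw [hRC.eq, ← mul_assoc, mul_assoc (n s), hC, mul_assoc, ← hRC.eq, ← mul_assoc, hnR]
  have hPN (s : ℝ) : Commute (n s * C) P :=
    ((hnR' s).mul_right (hnC s)).mul_left (hRC.symm.mul_right (Commute.refl _))
  have hQQ (v : E) : Q (Q v) = Q v := congrArg (fun S : E →L[ℝ] E => S v) hQ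
  obtain ⟨G, hG, hGQ, hGe⟩ := exists_inverse_along hA hQ
    (fun s => (Commute.one_left _).sub_left (hρQ _)) fun v hv => by
      rw [h0] at hv
      rw [← hQQ, hQk _ hv]
  -- On the range of `P` the operator at `s = 0` is `-X`. It is injective there, since that range is
  -- fixed by `R` while `R` kills the kernel of `X`.
  obtain ⟨M, hM, hMP, hMe⟩ := exists_inverse_along hN hP hPN fun v hv => by
    have hCP : C * P = P := by
      simp only [P]
      rw [hRC.eq, ← mul_assoc, hC]
    have hRP : R * P = P := by
      simp only [P]
      rw [← mul_assoc, hR]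
    have h1 : n 0 (P v) = 0 := by
      have h2 : (n 0 * (C * P)) v = 0 := hv
      rwa [hCP] at h2
    rw [hn0] at h1
    have h2 : R (P v) = 0 := hRk _ (neg_eq_zero.1 h1)
    have h3 : R (P v) = P v := congrArg (fun S : E →L[ℝ] E => S v) hRP
    rw [← h3, h2]
  exact ⟨{
    Q := Q
    P := P
    G := G
    N := fun s => n s * C
    M := M
    contDiff_A := hA
    contDiff_G := hG
    contDiff_N := hN
    contDiff_M := hM
    Q_mul_Q := hQ
    Q_mul_P := by
      simp only [P]
      rw [hRC.eq, ← mul_assoc, hQC, zero_mul]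
    P_mul_Q := by
      simp only [P]
      rw [mul_assoc, hCQ, mul_zero]
    commute_A := fun s => (Commute.one_left _).sub_left (hρQ _)
    A_mul := hAC
    N_mul_P := hNP
    P_mul_N := fun s => (hPN s).eq.symm.trans (hNP s)
    N_zero := by rw [hn0, neg_mul]
    G_mul_Q := hGQ
    M_mul_P := hMP
    eventually_G := hGe
    eventually_M := hMe }⟩

end CircleAction

end CircleLoop

namespace CircleLoop

open Filter Topology

/-! ### Passing between `S¹ × V` and `ℝ × E` -/

section Gluing

variable {E F : Type} [NormedAddCommGroup E] [NormedSpace ℝ E]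
  [NormedAddCommGroup F] [NormedSpace ℝ F] {V : Opens E}

omit [NormedSpace ℝ E] in
theorem chartAt_opens_apply (p v : V) : chartAt E p v = (v : E) := rfl

omit [NormedSpace ℝ E] in
theorem chartAt_opens_target (p : V) : (chartAt E p).target = (V : Set E) := by
  ext v
  constructor
  · intro hv
    have h := (chartAt E p).right_inv hv
    rw [chartAt_opens_apply] at h
    rw [← h]
    exact Subtype.coe_prop _
  · intro hv
    exact (chartAt E p).map_source (x := ⟨v, hv⟩) (by simp [Opens.chartAt_eq, chartAt_self_eq])

omit [NormedSpace ℝ E] in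
theorem chartAt_opens_symm_apply (p : V) {v : E} (hv : v ∈ V) :
    (chartAt E p).symm v = ⟨v, hv⟩ := by
  have h : v ∈ (chartAt E p).target := by rwa [chartAt_opens_target]
  exact Subtype.ext ((chartAt E p).right_inv h)

theorem contMDiffAt_chartAt_opens_symm (p : V) {v : E} (hv : v ∈ V) :
    ContMDiffAt 𝓘(ℝ, E) 𝓘(ℝ, E) ∞ (chartAt E p).symm v := by
  have h : (chartAt E p).target ∈ 𝓝 v := by
    rw [chartAt_opens_target]
    exact V.isOpen.mem_nhds hv
  exact (contMDiffOn_chart_symm (I := 𝓘(ℝ, E)) (x := p)).contMDiffAt h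

/-- The family `χ α` near `g₀`, in the coordinates `(s, v) ↦ (g₀ exp (i s), v)`, extended by
zero. -/
def extendNear (χ : E → ℝ) (g₀ : Circle) (α : Circle × V → F) (p : ℝ × E) : F :=
  open Classical in
  if h : p.2 ∈ V then χ p.2 • α (g₀ * Circle.exp p.1, ⟨p.2, h⟩) else 0

omit [NormedSpace ℝ E] in
theorem extendNear_of_mem (χ : E → ℝ) (g₀ : Circle) (α : Circle × V → F) (s : ℝ) (v : V) :
    extendNear χ g₀ α (s, v) = χ v • α (g₀ * Circle.exp s, v) :=
  dif_pos v.2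

omit [NormedSpace ℝ E] in
theorem extendNear_of_notMem (χ : E → ℝ) (g₀ : Circle) (α : Circle × V → F) {s : ℝ} {v : E}
    (hv : v ∉ V) : extendNear χ g₀ α (s, v) = 0 :=
  dif_neg hv

/-- A point outside `V` lies off the closed support of `χ`, so the extension is zero in a
neighbourhood of it. -/
theorem contDiff_extendNear {χ : E → ℝ} (hχ : ContDiff ℝ ∞ χ) (hs : tsupport χ ⊆ V) (g₀ : Circle)
    {α : Circle × V → F} (hα : ContMDiff ((𝓡 1).prod 𝓘(ℝ, E)) 𝓘(ℝ, F) ∞ α) :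
    ContDiff ℝ ∞ (extendNear χ g₀ α) := by
  refine contDiff_iff_contDiffAt.2 fun p => ?_
  by_cases hp : p.2 ∈ V
  · have h1 : ContMDiffAt 𝓘(ℝ, ℝ × E) (𝓡 1) ∞ (fun q : ℝ × E => g₀ * Circle.exp q.1) p :=
      (contMDiff_const.mul (contMDiff_circleExp.comp contDiff_fst.contMDiff)).contMDiffAt
    have h2 : ContMDiffAt 𝓘(ℝ, ℝ × E) 𝓘(ℝ, E) ∞
        (fun q : ℝ × E => (chartAt E (⟨p.2, hp⟩ : V)).symm q.2) p :=
      (contMDiffAt_chartAt_opens_symm _ hp).comp p contDiff_snd.contMDiff.contMDiffAt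
    have h3 := ((hα.contMDiffAt.comp p (h1.prodMk h2)).contDiffAt)
    have h4 := (hχ.comp contDiff_snd).contDiffAt (x := p).smul h3
    refine h4.congr_of_eventuallyEq ?_
    filter_upwards [(V.isOpen.preimage continuous_snd).mem_nhds hp] with q hq
    change _ = χ q.2 • α (g₀ * Circle.exp q.1, (chartAt E (⟨p.2, hp⟩ : V)).symm q.2)
    rw [chartAt_opens_symm_apply _ hq]
    exact extendNear_of_mem χ g₀ α q.1 ⟨q.2, hq⟩
  · refine contDiffAt_const (c := (0 : F)) |>.congr_of_eventuallyEq ?_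
    have h : (tsupport χ)ᶜ ∈ 𝓝 p.2 :=
      (isClosed_tsupport χ).isOpen_compl.mem_nhds fun h => hp (hs h)
    filter_upwards [continuous_snd.continuousAt.preimage_mem_nhds h] with q hq
    by_cases hq' : q.2 ∈ V
    · rw [extendNear, dif_pos hq', image_eq_zero_of_notMem_tsupport hq, zero_smul]
    · exact dif_neg hq'

/-- The angle from `g₀` to `g`. -/
def angleFrom (g₀ g : Circle) : ℝ := Complex.arg (g / g₀ : Circle)

theorem mul_exp_angleFrom (g₀ g : Circle) : g₀ * Circle.exp (angleFrom g₀ g) = g := by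
  rw [angleFrom, Circle.exp_arg, mul_div_cancel]

/-- The angle is the imaginary part of the logarithm, which is smooth on the slit plane. -/
theorem contMDiffAt_angleFrom {g₀ g : Circle} (h : ((g / g₀ : Circle) : ℂ) ∈ Complex.slitPlane) :
    ContMDiffAt (𝓡 1) 𝓘(ℝ, ℝ) ∞ (angleFrom g₀) g := by
  have h1 : ContMDiff (𝓡 1) 𝓘(ℝ, ℂ) ∞ fun g : Circle => ((g / g₀ : Circle) : ℂ) := by
    have h2 : ContMDiff (𝓡 1) 𝓘(ℝ, ℂ) ∞ fun g : Circle => (g : ℂ) :=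
      haveI : Fact (Module.finrank ℝ ℂ = 1 + 1) := finrank_real_complex_fact'
      contMDiff_coe_sphere
    exact h2.comp (contMDiff_id.div contMDiff_const)
  have h3 : ContDiffAt ℝ ∞ Complex.log ((g / g₀ : Circle) : ℂ) :=
    (Complex.contDiffAt_log h).restrict_scalars ℝ
  have h4 := (Complex.imCLM.contDiff.contDiffAt.comp _ h3).contMDiffAt.comp g h1.contMDiffAt
  refine h4.congr_of_eventuallyEq (Eventually.of_forall fun g => ?_)
  simp [angleFrom, Complex.log_im]

theorem tendsto_angleFrom (g₀ : Circle) : Tendsto (angleFrom g₀) (𝓝 g₀) (𝓝 0) := by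
  have h := (contMDiffAt_angleFrom (g₀ := g₀) (g := g₀) (by simp)).continuousAt
  have h0 : angleFrom g₀ g₀ = 0 := by simp [angleFrom]
  rw [ContinuousAt, h0] at h
  exact h

/-- Local solutions, in the coordinates `(s, v) ↦ (g₀ exp (i s), v)`, of a convex condition can be
glued. -/
theorem exists_contMDiff_forall_mem_of_local [FiniteDimensional ℝ E] {t : Circle × V → Set F}
    (ht : ∀ x, Convex ℝ (t x))
    (h : ∀ (g₀ : Circle) (χ : E → ℝ), ContDiff ℝ ∞ χ → tsupport χ ⊆ V →
      ∃ u : ℝ × E → F, ContDiff ℝ ∞ u ∧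
        ∀ᶠ s in 𝓝 (0 : ℝ), ∀ v : V, (∀ᶠ y in 𝓝 (v : E), χ y = 1) → u (s, v) ∈ t (g₀ * Circle.exp s, v)) :
    ∃ f : Circle × V → F, ContMDiff ((𝓡 1).prod 𝓘(ℝ, E)) 𝓘(ℝ, F) ∞ f ∧ ∀ x, f x ∈ t x := by
  have hl (x : Circle × V) : ∃ U ∈ 𝓝 x, ∃ f : Circle × V → F,
      ContMDiffOn ((𝓡 1).prod 𝓘(ℝ, E)) 𝓘(ℝ, F) ∞ f U ∧ ∀ y ∈ U, f y ∈ t y := by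
    obtain ⟨g₀, p⟩ := x
    obtain ⟨χ, hχ, h1, hs⟩ := exists_contDiff_cutoff (V.isOpen.mem_nhds p.2)
    obtain ⟨u, hu, hut⟩ := h g₀ χ hχ hs
    have e1 : ∀ᶠ g in 𝓝 g₀, ((g / g₀ : Circle) : ℂ) ∈ Complex.slitPlane := by
      have hc : Continuous fun g : Circle => ((g / g₀ : Circle) : ℂ) := by fun_prop
      exact hc.continuousAt.eventually_mem (Complex.isOpen_slitPlane.mem_nhds (by simp))
    have e2 := (tendsto_angleFrom g₀).eventually hut
    have e3 : ∀ᶠ v : V in 𝓝 p, ∀ᶠ y in 𝓝 (v : E), χ y = 1 :=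
      continuous_subtype_val.continuousAt.eventually h1.eventually_nhds
    refine ⟨_, (e1.and e2).prod_nhds e3, fun y => u (angleFrom g₀ y.1, y.2), fun y hy => ?_,
      fun y hy => ?_⟩
    · have h1 : ContMDiffAt ((𝓡 1).prod 𝓘(ℝ, E)) 𝓘(ℝ, ℝ) ∞
          (fun y : Circle × V => angleFrom g₀ y.1) y :=
        (contMDiffAt_angleFrom hy.1.1).comp y contMDiff_fst.contMDiffAt
      have h2 : ContMDiffAt ((𝓡 1).prod 𝓘(ℝ, E)) 𝓘(ℝ, E) ∞
          (fun y : Circle × V => (y.2 : E)) y :=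
        (contMDiff_subtype_val.comp contMDiff_snd).contMDiffAt
      exact (hu.contMDiff.contMDiffAt.comp y (h1.prodMk_space h2)).contMDiffWithinAt
    · have h2 := hy.1.2 y.2 hy.2
      rwa [mul_exp_angleFrom] at h2
  have : ProperSpace E := FiniteDimensional.proper ℝ E
  have : LocallyCompactSpace V := V.isOpen.locallyCompactSpace
  obtain ⟨f, hf⟩ := exists_contMDiffMap_forall_mem_convex_of_local ((𝓡 1).prod 𝓘(ℝ, E)) ht hl
  exact ⟨f, f.contMDiff, hf⟩

end Gluing

end CircleLoop

namespace CircleLoop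

open Filter Topology ContinuousAlternatingMap

/-! ### The ideal of the loop space -/

section Ideal

variable {𝕜 : Type} [RCLike 𝕜] {E F G W : Type} [NormedAddCommGroup E] [NormedSpace ℝ E]
  [NormedAddCommGroup F] [NormedSpace ℝ F] [NormedAddCommGroup G] [NormedSpace ℝ G]
  [NormedAddCommGroup W] [NormedSpace ℝ W] {V : Opens E} {k : ℕ}

/-- Smoothness of a family on `S¹ × V` with values in a vector space. -/
abbrev SmoothFamily (f : Circle × V → F) : Prop :=
  ContMDiff ((𝓡 1).prod 𝓘(ℝ, E)) 𝓘(ℝ, F) ∞ f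

theorem SmoothFamily.map {φ : F → W} (hφ : ContDiff ℝ ∞ φ) {f : Circle × V → F}
    (hf : SmoothFamily f) : SmoothFamily fun x => φ (f x) :=
  hφ.contMDiff.comp hf

theorem SmoothFamily.map₂ {φ : F × G → W} (hφ : ContDiff ℝ ∞ φ) {f : Circle × V → F}
    {g : Circle × V → G} (hf : SmoothFamily f) (hg : SmoothFamily g) :
    SmoothFamily fun x => φ (f x, g x) :=
  hφ.contMDiff.comp (hf.prodMk_space hg)

theorem SmoothFamily.contDiff_exp {f : Circle × V → F}
    (hf : SmoothFamily f) (g₀ : Circle) (v : V) :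
    ContDiff ℝ ∞ fun s : ℝ => f (g₀ * Circle.exp s, v) :=
  (hf.comp ((contMDiff_const.mul contMDiff_circleExp).prodMk contMDiff_const)).contDiff

theorem smoothFamily_rho {ρ : Circle →* (E →L[ℝ] E)}
    (hρ : ContMDiff (𝓡 1) 𝓘(ℝ, E →L[ℝ] E) ∞ ρ) :
    SmoothFamily fun x : Circle × V => 1 - ρ x.1 :=
  contMDiff_const.sub (hρ.comp contMDiff_fst)

theorem convex_setOf_eq {φ : F → G} (ha : ∀ a b, φ (a + b) = φ a + φ b)
    (hs : ∀ (c : ℝ) a, φ (c • a) = c • φ a) (y : G) : Convex ℝ {a | φ a = y} :=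
  (convex_singleton y).is_linear_preimage ⟨ha, hs⟩

theorem convex_setOf_forall {ι : Type} {P : ι → F → Prop} (h : ∀ i, Convex ℝ {a | P i a}) :
    Convex ℝ {a | ∀ i, P i a} := by
  intro a ha b hb c d hc hd hcd i
  exact h i (ha i) (hb i) hc hd hcd

theorem dRel_eq_fderiv {f : Circle × V → 𝕜} (hf : SmoothFamily f) (g : Circle) (v : V)
    {f' : E → 𝕜} (h : ∀ᶠ y in 𝓝 (v : E), ∀ hy : y ∈ V, f' y = f (g, ⟨y, hy⟩)) :
    dRel f (g, v) = fderiv ℝ f' v := by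
  have hd : MDifferentiableAt 𝓘(ℝ, E) 𝓘(ℝ, 𝕜) (fun v : V => f (g, v)) v :=
    ((hf.comp (contMDiff_const.prodMk contMDiff_id)).contMDiffAt).mdifferentiableAt (by simp)
  refine hd.mfderiv.trans ?_
  rw [ModelWithCorners.range_eq_univ, fderivWithin_univ]
  refine Filter.EventuallyEq.fderiv_eq (𝕜 := ℝ) (x := (v : E)) ?_
  filter_upwards [h, V.isOpen.mem_nhds v.2] with y hy hyV
  rw [hy hyV]
  change f (g, (chartAt E v).symm y) = _
  rw [chartAt_opens_symm_apply v hyV]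

/-- Locally `f = l(Y)`, and differentiating along `V` gives `d_rel f` with `L` the derivative of
`l`. Gluing need not preserve that relation, so `L` is carried as an independent unknown: the two
equations are affine in `(l, L)`. -/
theorem exists_hadamard [FiniteDimensional ℝ E] {ρ : Circle →* (E →L[ℝ] E)}
    (hρ : ContMDiff (𝓡 1) 𝓘(ℝ, E →L[ℝ] E) ∞ ρ) {f : Circle × V → 𝕜}
    (hf : f ∈ vanishingIdeal 𝕜 ρ V) :
    ∃ l : Circle × V → E →L[ℝ] 𝕜, SmoothFamily l ∧
      ∃ L : Circle × V → E →L[ℝ] E →L[ℝ] 𝕜, SmoothFamily L ∧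
        ∀ x, f x = l x (fieldY ρ V x) ∧
          ∀ w, dRel f x w = l x ((1 - ρ x.1) w) + L x w (fieldY ρ V x) := by
  let t : Circle × V → Set ((E →L[ℝ] 𝕜) × (E →L[ℝ] E →L[ℝ] 𝕜)) := fun x =>
    {q | q.1 (fieldY ρ V x) = f x ∧
      ∀ w, q.1 ((1 - ρ x.1) w) + q.2 w (fieldY ρ V x) = dRel f x w}
  obtain ⟨u, hu, h⟩ : ∃ u : Circle × V → _, SmoothFamily u ∧ ∀ x, u x ∈ t x := by
    refine exists_contMDiff_forall_mem_of_local (fun x => ?_) (fun g₀ χ hχ hs => ?_)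
    · refine Convex.inter (convex_setOf_eq (fun _ _ => rfl) (fun _ _ => rfl) _) ?_
      exact convex_setOf_forall fun w => convex_setOf_eq (fun a b => add_add_add_comm _ _ _ _)
        (fun c a => (smul_add _ _ _).symm) _
    · obtain ⟨S⟩ := nonempty_localSplitting hρ g₀
      let C := constOfIsEmptyLIE ℝ E 𝕜 (Fin 0)
      have hC : SmoothFamily fun x => C (f x) := SmoothFamily.map C.contDiff hf.1
      obtain ⟨a, ha, e⟩ := S.exists_eq_apply_field (contDiff_extendNear hχ hs g₀ hC) fun s v hv => by
        by_cases hvV : v ∈ V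
        · have h0 : f (g₀ * Circle.exp s, ⟨v, hvV⟩) = 0 :=
            hf.2 _ (sub_eq_zero.1 hv).symm
          rw [extendNear_of_mem χ g₀ _ s ⟨v, hvV⟩, h0, _root_.map_zero, smul_zero]
        · exact extendNear_of_notMem _ _ _ hvV
      let l : ℝ × E → E →L[ℝ] 𝕜 := fun p =>
        (C.symm : _ →L[ℝ] 𝕜).comp (a p)
      have hl : ContDiff ℝ ∞ l := contDiff_const.clm_comp ha
      have hl' : ContDiff ℝ ∞ (fderiv ℝ l) := hl.fderiv_right (by simp)
      let L : ℝ × E → E →L[ℝ] E →L[ℝ] 𝕜 := fun p => (fderiv ℝ l p).comp (.inr ℝ ℝ E)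
      refine ⟨fun p => (l p, L p), hl.prodMk (hl'.clm_comp contDiff_const), e.mono ?_⟩
      intro s hs v hv
      have e1 (y : V) : l (s, y) (fieldNear ρ g₀ s y) = χ y • f (g₀ * Circle.exp s, y) := by
        have h1 := congrArg C.symm (hs y)
        rw [extendNear_of_mem] at h1
        rw [_root_.map_smul, C.symm_apply_apply] at h1
        exact h1.symm
      refine ⟨?_, fun w => ?_⟩
      · have := e1 v
        rwa [hv.self_of_nhds, one_smul] at this
      · have e2 : ∀ᶠ y in 𝓝 (v : E), ∀ hy : y ∈ V,
            l (s, y) (fieldNear ρ g₀ s y) = f (g₀ * Circle.exp s, ⟨y, hy⟩) :=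
          hv.mono fun y hy hyV => by rw [e1 ⟨y, hyV⟩, hy, one_smul]
        rw [dRel_eq_fderiv hf.1 _ v e2]
        have h1 : HasFDerivAt (fun y : E => l (s, y)) (L (s, v)) v :=
          ((hl.differentiable (by simp) (s, v.1)).hasFDerivAt).comp v.1 (hasFDerivAt_prodMk_right s v.1)
        rw [(h1.clm_apply (fieldNear ρ g₀ s).hasFDerivAt).fderiv]
        rfl
  exact ⟨fun x => (u x).1, SmoothFamily.map contDiff_fst hu, fun x => (u x).2, SmoothFamily.map contDiff_snd hu,
    fun x => ⟨(h x).1.symm, fun w => ((h x).2 w).symm⟩⟩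

end Ideal

end CircleLoop

namespace CircleLoop

open Filter Topology ContinuousAlternatingMap

/-! ### The ideal of the loop space in terms of the components of `Y` and their differentials. -/

section Ideal

variable {𝕜 : Type} [RCLike 𝕜] {E : Type} [NormedAddCommGroup E] [NormedSpace ℝ E]
  {V : Opens E} {k : ℕ}

theorem contDiff_smul_form :
    ContDiff ℝ ∞ fun q : 𝕜 × (E [⋀^Fin k]→L[ℝ] 𝕜) => q.1 • q.2 :=
  ((ContinuousLinearMap.lsmul ℝ 𝕜 : 𝕜 →L[ℝ] _ →L[ℝ] (E [⋀^Fin k]→L[ℝ] 𝕜)).contDiff.comp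
    contDiff_fst).clm_apply contDiff_snd

theorem contDiff_smulRight [FiniteDimensional ℝ E] :
    ContDiff ℝ ∞ fun q : (E →L[ℝ] 𝕜) × (E [⋀^Fin k]→L[ℝ] 𝕜) => q.1.smulRight q.2 :=
  contDiff_clm_apply_iff.2 fun _ =>
    contDiff_smul_form.comp (((contDiff_fst.clm_apply contDiff_const)).prodMk contDiff_snd)

theorem smoothFamily_smul (c : 𝕜) {a : Circle × V → E →L[ℝ] E [⋀^Fin k]→L[ℝ] 𝕜}
    (ha : SmoothFamily a) : SmoothFamily fun x => c • a x :=
  SmoothFamily.map (contDiff_const_smul c) ha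

theorem alternatizeUncurryFin_const_smul (c : 𝕜) (f : E →L[ℝ] E [⋀^Fin k]→L[ℝ] 𝕜) :
    alternatizeUncurryFin (c • f) = c • alternatizeUncurryFin f := by
  ext w
  rw [ContinuousAlternatingMap.smul_apply, alternatizeUncurryFin_apply,
    alternatizeUncurryFin_apply, Finset.smul_sum]
  exact Finset.sum_congr rfl fun i _ => smul_comm _ c _

/-- The map `u ↦ L(·, u) ∧ β`. -/
def wedgeFlip [FiniteDimensional ℝ E] (L : E →L[ℝ] E →L[ℝ] 𝕜) (β : E [⋀^Fin k]→L[ℝ] 𝕜) :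
    E →L[ℝ] E [⋀^Fin (k + 1)]→L[ℝ] 𝕜 :=
  LinearMap.toContinuousLinearMap
    { toFun := fun u => wedgeOne (L.flip u) β
      map_add' := fun u v => by
        ext w
        simp [wedgeOne_apply, add_mul, Finset.sum_add_distrib]
      map_smul' := fun c u => by
        ext w
        simp [wedgeOne_apply, Finset.smul_sum] }

theorem contDiff_wedgeFlip [FiniteDimensional ℝ E] :
    ContDiff ℝ ∞ fun q : (E →L[ℝ] E →L[ℝ] 𝕜) × (E [⋀^Fin k]→L[ℝ] 𝕜) =>
      wedgeFlip q.1 q.2 := by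
  refine contDiff_clm_apply_iff.2 fun u => ?_
  have h : ContDiff ℝ ∞ fun q : (E →L[ℝ] E →L[ℝ] 𝕜) × (E [⋀^Fin k]→L[ℝ] 𝕜) => q.1.flip u :=
    contDiff_clm_apply_iff.2 fun w =>
      (contDiff_fst.clm_apply contDiff_const).clm_apply contDiff_const
  exact contDiff_alternatizeUncurryFin.comp (contDiff_smulRight.comp (h.prodMk contDiff_snd))

theorem RelForm.sum_val {ι : Type} (s : Finset ι) (α : ι → RelForm 𝕜 V k) (x : Circle × V) :
    (∑ i ∈ s, α i).val x = ∑ i ∈ s, (α i).val x := by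
  classical
  induction s using Finset.induction_on with
  | empty => rfl
  | insert i s hi h => rw [Finset.sum_insert hi, Finset.sum_insert hi, add_val, h]

variable [FiniteDimensional ℝ E] {ρ : Circle →* (E →L[ℝ] E)}

/-- With `f = l(Y)` from `exists_hadamard`, the product `f α` is `(l ⊗ α)(Y)`. -/
theorem exists_eq_of_mem_idealTimesForms (hρ : ContMDiff (𝓡 1) 𝓘(ℝ, E →L[ℝ] E) ∞ ρ)
    {σ : RelForm 𝕜 V k} (hσ : σ ∈ idealTimesForms 𝕜 ρ V k) :
    ∃ a : Circle × V → E →L[ℝ] E [⋀^Fin k]→L[ℝ] 𝕜, SmoothFamily a ∧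
      ∀ x, σ.val x = a x (fieldY ρ V x) := by
  induction hσ using Submodule.span_induction with
  | mem σ h =>
    obtain ⟨f, hf, α, e⟩ := h
    obtain ⟨l, hl, L, hL, e'⟩ := exists_hadamard hρ hf
    refine ⟨fun x => (l x).smulRight (α.val x),
      SmoothFamily.map₂ contDiff_smulRight hl α.smooth, fun x => ?_⟩
    rw [e, (e' x).1]
    rfl
  | zero => exact ⟨fun _ => 0, contMDiff_const, fun x => rfl⟩
  | add σ τ _ _ hσ hτ =>
    obtain ⟨a, ha, e⟩ := hσ
    obtain ⟨b, hb, e'⟩ := hτ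
    exact ⟨fun x => a x + b x, ha.add hb, fun x => by
      rw [RelForm.add_val, e, e', _root_.add_apply]⟩
  | smul c σ _ hσ =>
    obtain ⟨a, ha, e⟩ := hσ
    exact ⟨fun x => c • a x, smoothFamily_smul c ha, fun x => by
      rw [RelForm.smul_val, e]
      rfl⟩

/-- The two terms of `d_rel f` in `exists_hadamard` give the two summands: `L(·, Y) ∧ η` is linear
in `Y`, and `(l ∘ (1 - ρ)) ∧ η` alternates `(l ⊗ η) ∘ (1 - ρ)`. -/
theorem exists_eq_of_mem_dIdealWedgeForms (hρ : ContMDiff (𝓡 1) 𝓘(ℝ, E →L[ℝ] E) ∞ ρ)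
    {σ : RelForm 𝕜 V (k + 1)} (hσ : σ ∈ dIdealWedgeForms 𝕜 ρ V (k + 1)) :
    ∃ a : Circle × V → E →L[ℝ] E [⋀^Fin (k + 1)]→L[ℝ] 𝕜, SmoothFamily a ∧
      ∃ b : Circle × V → E →L[ℝ] E [⋀^Fin k]→L[ℝ] 𝕜, SmoothFamily b ∧
        ∀ x, σ.val x = a x (fieldY ρ V x) + alternatizeUncurryFin ((b x).comp (1 - ρ x.1)) := by
  rw [dIdealWedgeForms] at hσ
  induction hσ using Submodule.span_induction with
  | mem σ h =>
    obtain ⟨f, hf, η, e⟩ := h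
    obtain ⟨l, hl, L, hL, e'⟩ := exists_hadamard hρ hf
    refine ⟨fun x => wedgeFlip (L x) (η.val x), SmoothFamily.map₂ contDiff_wedgeFlip hL η.smooth,
      fun x => (l x).smulRight (η.val x),
      SmoothFamily.map₂ contDiff_smulRight hl η.smooth, fun x => ?_⟩
    have e1 : dRel f x = (L x).flip (fieldY ρ V x) + (l x).comp (1 - ρ x.1) :=
      ContinuousLinearMap.ext fun w => ((e' x).2 w).trans (add_comm _ _)
    rw [e, e1]
    change _ = wedgeOne ((L x).flip (fieldY ρ V x)) (η.val x) +
      wedgeOne ((l x).comp (1 - ρ x.1)) (η.val x)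
    ext w
    simp only [wedgeOne_apply, ContinuousAlternatingMap.add_apply, _root_.add_apply, add_mul, smul_add,
      Finset.sum_add_distrib]
  | zero => exact ⟨fun _ => 0, contMDiff_const, fun _ => 0, contMDiff_const, fun _ => by
      rw [ContinuousLinearMap.zero_comp, alternatizeUncurryFin_zero]
      exact (add_zero 0).symm⟩
  | add σ τ _ _ hσ hτ =>
    obtain ⟨a, ha, b, hb, e⟩ := hσ
    obtain ⟨a', ha', b', hb', e'⟩ := hτ
    refine ⟨fun x => a x + a' x, ha.add ha', fun x => b x + b' x, hb.add hb', fun x => ?_⟩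
    rw [RelForm.add_val, e, e', _root_.add_apply, ContinuousLinearMap.add_comp,
      alternatizeUncurryFin_add]
    abel
  | smul c σ _ hσ =>
    obtain ⟨a, ha, b, hb, e⟩ := hσ
    refine ⟨fun x => c • a x, smoothFamily_smul c ha, fun x => c • b x,
      smoothFamily_smul c hb, fun x => ?_⟩
    rw [RelForm.smul_val, e, smul_add, ← alternatizeUncurryFin_const_smul]
    rfl

theorem exists_eq_of_mem_sup (hρ : ContMDiff (𝓡 1) 𝓘(ℝ, E →L[ℝ] E) ∞ ρ)
    {σ : RelForm 𝕜 V (k + 1)}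
    (hσ : σ ∈ idealTimesForms 𝕜 ρ V (k + 1) ⊔ dIdealWedgeForms 𝕜 ρ V (k + 1)) :
    ∃ a : Circle × V → E →L[ℝ] E [⋀^Fin (k + 1)]→L[ℝ] 𝕜, SmoothFamily a ∧
      ∃ b : Circle × V → E →L[ℝ] E [⋀^Fin k]→L[ℝ] 𝕜, SmoothFamily b ∧
        ∀ x, σ.val x = a x (fieldY ρ V x) + alternatizeUncurryFin ((b x).comp (1 - ρ x.1)) := by
  obtain ⟨τ₁, hτ₁, τ, hτ, rfl⟩ := Submodule.mem_sup.1 hσ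
  obtain ⟨a, ha, e⟩ := exists_eq_of_mem_idealTimesForms hρ hτ₁
  obtain ⟨a', ha', b, hb, e'⟩ := exists_eq_of_mem_dIdealWedgeForms hρ hτ
  refine ⟨fun x => a x + a' x, ha.add ha', b, hb, fun x => ?_⟩
  rw [RelForm.add_val, e, e', _root_.add_apply, add_assoc]

/-- The components of the field `Y`, as functions with values in `𝕜`. -/
def fieldCoord (𝕜 : Type) [RCLike 𝕜] (ρ : Circle →* (E →L[ℝ] E)) (V : Opens E)
    (i : Fin (Module.finrank ℝ E)) (x : Circle × V) : 𝕜 :=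
  RCLike.ofRealCLM ((Module.finBasis ℝ E).coord i (fieldY ρ V x))

theorem fieldCoord_mem (hρ : ContMDiff (𝓡 1) 𝓘(ℝ, E →L[ℝ] E) ∞ ρ)
    (i : Fin (Module.finrank ℝ E)) : fieldCoord 𝕜 ρ V i ∈ vanishingIdeal 𝕜 ρ V := by
  refine ⟨SmoothFamily.map (φ := fun v : E => (RCLike.ofRealCLM
    ((Module.finBasis ℝ E).coord i v) : 𝕜)) ?_ (contMDiff_fieldY ρ hρ V), fun x hx => ?_⟩
  · exact (RCLike.ofRealCLM (K := 𝕜)).contDiff.comp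
      (LinearMap.toContinuousLinearMap ((Module.finBasis ℝ E).coord i)).contDiff
  · have h : fieldY ρ V x = 0 := sub_eq_zero.2 (Eq.symm hx)
    rw [fieldCoord, h, _root_.map_zero, _root_.map_zero]

theorem dRel_fieldCoord (hρ : ContMDiff (𝓡 1) 𝓘(ℝ, E →L[ℝ] E) ∞ ρ)
    (i : Fin (Module.finrank ℝ E)) (x : Circle × V) (w : E) :
    dRel (fieldCoord 𝕜 ρ V i) x w =
      ((Module.finBasis ℝ E).coord i ((1 - ρ x.1) w) : ℝ) := by
  obtain ⟨g, v⟩ := x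
  let φ : E →L[ℝ] 𝕜 := RCLike.ofRealCLM.comp
    ((LinearMap.toContinuousLinearMap ((Module.finBasis ℝ E).coord i)).comp (1 - ρ g))
  rw [dRel_eq_fderiv (f' := φ) (fieldCoord_mem hρ i).1 g v
    (Eventually.of_forall fun y hy => rfl), φ.fderiv]
  rfl

theorem apply_eq_sum {W : Type} [NormedAddCommGroup W] [NormedSpace ℝ W] (f : E →L[ℝ] W) (v : E) :
    f v = ∑ i, (Module.finBasis ℝ E).coord i v • f (Module.finBasis ℝ E i) := by
  conv_lhs => rw [← (Module.finBasis ℝ E).sum_repr v, _root_.map_sum]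
  simp only [_root_.map_smul]
  rfl

theorem mem_idealTimesForms (hρ : ContMDiff (𝓡 1) 𝓘(ℝ, E →L[ℝ] E) ∞ ρ) {σ : RelForm 𝕜 V k}
    {a : Circle × V → E →L[ℝ] E [⋀^Fin k]→L[ℝ] 𝕜} (ha : SmoothFamily a)
    (e : ∀ x, σ.val x = a x (fieldY ρ V x)) : σ ∈ idealTimesForms 𝕜 ρ V k := by
  let α (i : Fin (Module.finrank ℝ E)) : RelForm 𝕜 V k :=
    ⟨fun x => a x (Module.finBasis ℝ E i), ha.clm_apply contMDiff_const⟩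
  let τ (i : Fin (Module.finrank ℝ E)) : RelForm 𝕜 V k :=
    ⟨fun x => fieldCoord 𝕜 ρ V i x • (α i).val x,
      SmoothFamily.map₂ contDiff_smul_form (fieldCoord_mem hρ i).1 (α i).smooth⟩
  have h : σ = ∑ i, τ i := by
    refine RelForm.ext (funext fun x => ?_)
    rw [RelForm.sum_val, e, apply_eq_sum]
    refine Finset.sum_congr rfl fun i _ => ?_
    ext w
    simp [τ, α, fieldCoord, RCLike.real_smul_eq_coe_mul]
  rw [h]
  exact Submodule.sum_mem _ fun i _ =>
    Submodule.subset_span ⟨_, fieldCoord_mem hρ i, α i, fun _ => rfl⟩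

/-- Expanding `1 - ρ` in a basis writes the form as a sum of wedges with the relative differentials
of the components of `Y`, which lie in the vanishing ideal. -/
theorem mem_dIdealWedgeForms (hρ : ContMDiff (𝓡 1) 𝓘(ℝ, E →L[ℝ] E) ∞ ρ)
    {σ : RelForm 𝕜 V (k + 1)}
    {b : Circle × V → E →L[ℝ] E [⋀^Fin k]→L[ℝ] 𝕜} (hb : SmoothFamily b)
    (e : ∀ x, σ.val x = alternatizeUncurryFin ((b x).comp (1 - ρ x.1))) :
    σ ∈ dIdealWedgeForms 𝕜 ρ V (k + 1) := by
  let β (i : Fin (Module.finrank ℝ E)) : RelForm 𝕜 V k :=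
    ⟨fun x => b x (Module.finBasis ℝ E i), hb.clm_apply contMDiff_const⟩
  let c (i : Fin (Module.finrank ℝ E)) (x : Circle × V) : E →L[ℝ] 𝕜 := RCLike.ofRealCLM.comp
    ((LinearMap.toContinuousLinearMap ((Module.finBasis ℝ E).coord i)).comp (1 - ρ x.1))
  have hc (i) : c i = dRel (fieldCoord 𝕜 ρ V i) :=
    funext fun x => ContinuousLinearMap.ext fun w => (dRel_fieldCoord hρ i x w).symm
  have hs (i) : SmoothFamily (c i) :=
    SmoothFamily.map (contDiff_const.clm_comp (contDiff_const.clm_comp contDiff_id))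
      (smoothFamily_rho hρ)
  let τ (i : Fin (Module.finrank ℝ E)) : RelForm 𝕜 V (k + 1) :=
    ⟨fun x => wedgeOne (c i x) ((β i).val x), SmoothFamily.map contDiff_alternatizeUncurryFin
      (SmoothFamily.map₂ contDiff_smulRight (hs i) (β i).smooth)⟩
  have h : σ = ∑ i, τ i := by
    refine RelForm.ext (funext fun x => ?_)
    rw [RelForm.sum_val, e]
    have h1 : (b x).comp (1 - ρ x.1) = ∑ i, (c i x).smulRight ((β i).val x) := by
      ext w u
      rw [ContinuousLinearMap.comp_apply, apply_eq_sum]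
      simp [c, β, RCLike.real_smul_eq_coe_mul]
    rw [h1]
    exact _root_.map_sum (alternatizeUncurryFinCLM ℝ E 𝕜) _ _
  rw [h, dIdealWedgeForms]
  exact Submodule.sum_mem _ fun i _ =>
    Submodule.subset_span ⟨_, fieldCoord_mem hρ i, β i, fun x => by rw [← hc]⟩

theorem mem_sup (hρ : ContMDiff (𝓡 1) 𝓘(ℝ, E →L[ℝ] E) ∞ ρ) {σ : RelForm 𝕜 V (k + 1)}
    {a : Circle × V → E →L[ℝ] E [⋀^Fin (k + 1)]→L[ℝ] 𝕜} (ha : SmoothFamily a)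
    {b : Circle × V → E →L[ℝ] E [⋀^Fin k]→L[ℝ] 𝕜} (hb : SmoothFamily b)
    (e : ∀ x, σ.val x = a x (fieldY ρ V x) + alternatizeUncurryFin ((b x).comp (1 - ρ x.1))) :
    σ ∈ idealTimesForms 𝕜 ρ V (k + 1) ⊔ dIdealWedgeForms 𝕜 ρ V (k + 1) := by
  let τ : RelForm 𝕜 V (k + 1) := ⟨fun x => a x (fieldY ρ V x),
    ha.clm_apply (contMDiff_fieldY ρ hρ V)⟩
  have h : σ = τ + (σ + -τ) := by abel
  rw [h]
  refine Submodule.add_mem_sup (mem_idealTimesForms hρ ha fun _ => rfl)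
    (mem_dIdealWedgeForms hρ hb fun x => ?_)
  rw [RelForm.add_val, RelForm.neg_val, e]
  exact add_neg_cancel_comm _ _

end Ideal

end CircleLoop

namespace CircleLoop

open Filter Topology ContinuousAlternatingMap

/-! ### The restriction map on cycles -/

section Restriction

variable {𝕜 : Type} [RCLike 𝕜] {E : Type} [NormedAddCommGroup E] [NormedSpace ℝ E]
  [FiniteDimensional ℝ E] {V : Opens E} {k : ℕ} {ρ : Circle →* (E →L[ℝ] E)}

omit [FiniteDimensional ℝ E] in
theorem smoothFamily_curryLeft {α : Circle × V → E [⋀^Fin (k + 1)]→L[ℝ] 𝕜} (hα : SmoothFamily α) :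
    SmoothFamily fun x => (α x).curryLeft := by
  have h : IsBoundedLinearMap ℝ fun β : E [⋀^Fin (k + 1)]→L[ℝ] 𝕜 => β.curryLeft :=
    { map_add := fun _ _ => rfl
      map_smul := fun _ _ => rfl
      bound := ⟨1, one_pos, fun β => by rw [one_mul, norm_curryLeft]⟩ }
  exact SmoothFamily.map h.contDiff hα

theorem restrict_contractY (hρ : ContMDiff (𝓡 1) 𝓘(ℝ, E →L[ℝ] E) ∞ ρ) (k : ℕ) :
    restrict 𝕜 ρ V k ∘ₗ contractY 𝕜 ρ hρ V k = 0 := by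
  refine LinearMap.ext fun α => (Submodule.Quotient.mk_eq_zero _).2 (Submodule.mem_sup_left ?_)
  exact mem_idealTimesForms hρ (smoothFamily_curryLeft α.smooth) fun _ => rfl

omit [FiniteDimensional ℝ E] in
theorem apply_eq_zero_of_curryLeft {β : E [⋀^Fin (k + 1)]→L[ℝ] 𝕜} {u : E}
    (h : β.curryLeft u = 0) {w : Fin (k + 1) → E} {i : Fin (k + 1)} {c : ℝ} (hw : w i = c • u) :
    β w = 0 := by
  have e : w = i.insertNth (w i) (i.removeNth w) := (Fin.insertNth_self_removeNth i w).symm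
  have h1 := β.toAlternatingMap.map_insertNth i (w i) (i.removeNth w)
  have h2 : β (Matrix.vecCons (w i) (i.removeNth w)) = β.curryLeft (w i) (i.removeNth w) := rfl
  rw [e]
  refine h1.trans ?_
  change _ • β (Matrix.vecCons (w i) (i.removeNth w)) = 0
  rw [h2, hw, _root_.map_smul, h, smul_zero]
  exact smul_zero _

omit [FiniteDimensional ℝ E] in
-- Differentiate `i_Y α = 0` along `s ↦ (g exp (i s), p)`. At a point of the loop space `Y` is zero
-- and has derivative `-X p`, so only the contraction with `X p` survives.
theorem curryLeft_generator_eq_zero (hρ : ContMDiff (𝓡 1) 𝓘(ℝ, E →L[ℝ] E) ∞ ρ)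
    {α : RelForm 𝕜 V (k + 1)} (hα : α ∈ cycles 𝕜 ρ hρ V (k + 1)) {g : Circle} {p : V}
    (hp : (g, p) ∈ loopSpace ρ V) : (α.val (g, p)).curryLeft (generator ρ p) = 0 := by
  have hα0 (x : Circle × V) : (α.val x).curryLeft (fieldY ρ V x) = 0 :=
    congrFun (congrArg RelForm.val (LinearMap.mem_ker.1 hα)) x
  have hp' : ρ g (p : E) = p := hp
  have hY (s : ℝ) : fieldY ρ V (g * Circle.exp s, p) = (p : E) - ρ (Circle.exp s) p := by
    have : ρ (g * Circle.exp s) (p : E) = ρ (Circle.exp s) (p : E) := by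
      rw [map_mul, (commute_rho _ _).eq]
      exact congrArg (ρ (Circle.exp s)) hp'
    rw [fieldY, this]
  have h1 : HasDerivAt (fun s : ℝ => (p : E) - ρ (Circle.exp s) p) (-generator ρ p) 0 := by
    have := ((hasDerivAt_exp_zero hρ).clm_apply (hasDerivAt_const 0 (p : E))).const_sub (p : E)
    simpa using this
  have h2 : ContDiff ℝ ∞ fun s : ℝ => (α.val (g * Circle.exp s, p)).curryLeft :=
    SmoothFamily.contDiff_exp (smoothFamily_curryLeft α.smooth) g p
  have h3 := ((h2.differentiable (by simp) 0).hasDerivAt).clm_apply h1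
  have h4 : (fun s : ℝ => (α.val (g * Circle.exp s, p)).curryLeft
      ((p : E) - ρ (Circle.exp s) p)) = fun _ => 0 := funext fun s => by
    rw [← hY]
    exact hα0 _
  rw [h4] at h3
  have h5 := h3.unique (hasDerivAt_const (0 : ℝ) (0 : E [⋀^Fin k]→L[ℝ] 𝕜))
  simpa using h5

omit [FiniteDimensional ℝ E] in
theorem orbitTangent_eq_span (hρ : ContMDiff (𝓡 1) 𝓘(ℝ, E →L[ℝ] E) ∞ ρ) (p : E) :
    orbitTangent ρ p = Submodule.span ℝ {generator ρ p} := by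
  have := ((hasDerivAt_exp_zero hρ).clm_apply (hasDerivAt_const 0 p)).deriv
  rw [orbitTangent, this]
  simp

omit [FiniteDimensional ℝ E] in
theorem cycles_le_conormalForms (hρ : ContMDiff (𝓡 1) 𝓘(ℝ, E →L[ℝ] E) ∞ ρ) (k : ℕ) :
    cycles 𝕜 ρ hρ V k ≤ conormalForms 𝕜 ρ V k := by
  rintro α hα ⟨g, p⟩ hx w ⟨i, hi⟩
  cases k with
  | zero => exact i.elim0
  | succ k =>
    rw [orbitTangent_eq_span hρ] at hi
    obtain ⟨c, hc⟩ := Submodule.mem_span_singleton.1 hi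
    exact apply_eq_zero_of_curryLeft (curryLeft_generator_eq_zero hρ hα hx) hc.symm

/-- Cycles that vanish on the loop space are boundaries. -/
theorem mem_boundaries (hρ : ContMDiff (𝓡 1) 𝓘(ℝ, E →L[ℝ] E) ∞ ρ) {α : RelForm 𝕜 V k}
    (hα : α ∈ cycles 𝕜 ρ hρ V k)
    (h : α ∈ idealTimesForms 𝕜 ρ V k ⊔ dIdealWedgeForms 𝕜 ρ V k) :
    α ∈ boundaries 𝕜 ρ hρ V k := by
  cases k with
  | zero =>
    -- In degree zero the differentials contribute nothing, and `a` itself, regarded as a `1`-form,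
    -- is the primitive.
    rw [dIdealWedgeForms, sup_bot_eq] at h
    obtain ⟨a, ha, e⟩ := exists_eq_of_mem_idealTimesForms hρ h
    refine ⟨⟨_, SmoothFamily.map contDiff_alternatizeUncurryFin ha⟩,
      RelForm.ext (funext fun x => ?_)⟩
    rw [e]
    exact curryLeft_alternatizeUncurryFin_zero _ _
  | succ k =>
    have hα0 (x : Circle × V) : (α.val x).curryLeft (fieldY ρ V x) = 0 :=
      congrFun (congrArg RelForm.val (LinearMap.mem_ker.1 hα)) x
    obtain ⟨a, ha, b, hb, e⟩ := exists_eq_of_mem_sup hρ h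
    obtain ⟨ζ, hζ, h'⟩ : ∃ ζ : Circle × V → E [⋀^Fin (k + 2)]→L[ℝ] 𝕜, SmoothFamily ζ ∧
        ∀ x, ζ x ∈ {ζ : E [⋀^Fin (k + 2)]→L[ℝ] 𝕜 | ζ.curryLeft (fieldY ρ V x) = α.val x} := by
      refine exists_contMDiff_forall_mem_of_local
        (fun x => convex_setOf_eq (fun _ _ => rfl) (fun _ _ => rfl) _) fun g₀ χ hχ hs => ?_
      obtain ⟨S⟩ := nonempty_localSplitting hρ g₀
      have h0 (p : ℝ × E) : contract (fieldNear ρ g₀) (extendNear χ g₀ α.val) p = 0 := by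
        obtain ⟨s, v⟩ := p
        by_cases hv : v ∈ V
        · rw [contract, extendNear_of_mem χ g₀ _ s ⟨v, hv⟩]
          change χ v • (α.val (g₀ * Circle.exp s, ⟨v, hv⟩)).curryLeft
            (fieldY ρ V (g₀ * Circle.exp s, ⟨v, hv⟩)) = 0
          rw [hα0, smul_zero]
        · rw [contract, extendNear_of_notMem _ _ _ hv]
          rfl
      have h1 (s : ℝ) (v : E) : extendNear χ g₀ α.val (s, v) =
          extendNear χ g₀ a (s, v) (fieldNear ρ g₀ s v) +
            alternatizeUncurryFin ((extendNear χ g₀ b (s, v)).comp (fieldNear ρ g₀ s)) := by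
        by_cases hv : v ∈ V
        · rw [extendNear_of_mem χ g₀ _ s ⟨v, hv⟩, extendNear_of_mem χ g₀ _ s ⟨v, hv⟩,
            extendNear_of_mem χ g₀ _ s ⟨v, hv⟩, e, smul_add]
          refine congrArg₂ (· + ·) rfl ?_
          rw [ContinuousLinearMap.smul_comp]
          exact (_root_.map_smul (alternatizeUncurryFinCLM ℝ E 𝕜) (χ v) _).symm
        · rw [extendNear_of_notMem _ _ _ hv, extendNear_of_notMem _ _ _ hv,
            extendNear_of_notMem _ _ _ hv, ContinuousLinearMap.zero_comp,
            alternatizeUncurryFin_zero]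
          exact (add_zero 0).symm
      obtain ⟨ζ, hζ, h⟩ := S.exists_eq_contract (contDiff_extendNear hχ hs g₀ α.smooth) h0
        (contDiff_extendNear hχ hs g₀ ha) (contDiff_extendNear hχ hs g₀ hb) h1
      refine ⟨ζ, hζ, h.mono fun s h v hv => ?_⟩
      have h2 := h v
      rw [extendNear_of_mem, hv.self_of_nhds, one_smul] at h2
      exact h2.symm
    exact ⟨⟨ζ, hζ⟩, RelForm.ext (funext h')⟩

/-- Every conormal form agrees with a cycle on the loop space. -/
theorem exists_cycle (hρ : ContMDiff (𝓡 1) 𝓘(ℝ, E →L[ℝ] E) ∞ ρ) {α : RelForm 𝕜 V k}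
    (hα : α ∈ conormalForms 𝕜 ρ V k) :
    ∃ z ∈ cycles 𝕜 ρ hρ V k, restrict 𝕜 ρ V k z = restrict 𝕜 ρ V k α := by
  cases k with
  | zero => exact ⟨α, trivial, rfl⟩
  | succ k =>
    -- The cycle and the coefficients `a`, `b` of its difference from `α` are glued together, since
    -- the conditions are affine in the triple. This makes the global difference lie in the ideal.
    obtain ⟨q, hq, h⟩ : ∃ q : Circle × V → (E [⋀^Fin (k + 1)]→L[ℝ] 𝕜) ×
        ((E →L[ℝ] E [⋀^Fin (k + 1)]→L[ℝ] 𝕜) × (E →L[ℝ] E [⋀^Fin k]→L[ℝ] 𝕜)), SmoothFamily q ∧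
        ∀ x, q x ∈ {q : (E [⋀^Fin (k + 1)]→L[ℝ] 𝕜) ×
          ((E →L[ℝ] E [⋀^Fin (k + 1)]→L[ℝ] 𝕜) × (E →L[ℝ] E [⋀^Fin k]→L[ℝ] 𝕜)) |
          q.1.curryLeft (fieldY ρ V x) = 0 ∧ q.1 + (q.2.1 (fieldY ρ V x) +
            alternatizeUncurryFinCLM ℝ E 𝕜 (q.2.2.comp (1 - ρ x.1))) = α.val x} := by
      refine exists_contMDiff_forall_mem_of_local (fun x => ?_) fun g₀ χ hχ hs => ?_
      · refine Convex.inter (convex_setOf_eq (fun _ _ => rfl) (fun _ _ => rfl) _)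
          (convex_setOf_eq (fun q r => ?_) (fun c q => ?_) _)
        · simp only [Prod.fst_add, Prod.snd_add, ContinuousLinearMap.add_comp, _root_.map_add,
            _root_.add_apply]
          abel
        · simp only [Prod.smul_fst, Prod.smul_snd, ContinuousLinearMap.smul_comp, _root_.map_smul,
            smul_add]
          rfl
      · obtain ⟨S⟩ := nonempty_localSplitting hρ g₀
        have h0 (v : E) (hv : fieldNear ρ g₀ 0 v = 0) :
            (extendNear χ g₀ α.val (0, v)).curryLeft (generator ρ v) = 0 := by
          by_cases hvV : v ∈ V
          · rw [extendNear_of_mem χ g₀ _ 0 ⟨v, hvV⟩]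
            have h0 : (α.val (g₀ * Circle.exp 0, ⟨v, hvV⟩)).curryLeft (generator ρ v) = 0 := by
              ext w
              refine hα (g₀ * Circle.exp 0, ⟨v, hvV⟩) (sub_eq_zero.1 hv).symm _ ⟨0, ?_⟩
              rw [orbitTangent_eq_span hρ]
              exact Submodule.mem_span_singleton_self _
            change χ v • (α.val (g₀ * Circle.exp 0, ⟨v, hvV⟩)).curryLeft (generator ρ v) = 0
            rw [h0, smul_zero]
          · rw [extendNear_of_notMem _ _ _ hvV]
            rfl
        obtain ⟨z, hz, a, ha, b, hb, h⟩ :=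
          S.exists_eq_cycle_add (contDiff_extendNear hχ hs g₀ α.smooth) h0
        refine ⟨fun p => (z p, a p, b p), hz.prodMk (ha.prodMk hb), h.mono fun s h v hv => ?_⟩
        obtain ⟨h1, h2⟩ := h v
        rw [extendNear_of_mem, hv.self_of_nhds, one_smul] at h2
        exact ⟨h1, h2.symm⟩
    let z : RelForm 𝕜 V (k + 1) := ⟨fun x => (q x).1, SmoothFamily.map contDiff_fst hq⟩
    refine ⟨z, LinearMap.mem_ker.2 (RelForm.ext (funext fun x => (h x).1)), Eq.symm ?_⟩
    refine (Submodule.Quotient.eq _).2 (mem_sup hρ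
      (SmoothFamily.map (contDiff_fst.comp contDiff_snd) hq)
      (SmoothFamily.map (contDiff_snd.comp contDiff_snd) hq) fun x => ?_)
    rw [sub_eq_add_neg, RelForm.add_val, RelForm.neg_val, ← (h x).2]
    exact add_neg_cancel_comm _ _

/-- Restriction to the loop space, from cycles to horizontal forms. -/
def restrictCycles (hρ : ContMDiff (𝓡 1) 𝓘(ℝ, E →L[ℝ] E) ∞ ρ) (k : ℕ) :
    cycles 𝕜 ρ hρ V k →ₗ[𝕜] horizontalForms 𝕜 ρ V k :=
  (restrict 𝕜 ρ V k).restrict fun _ hα =>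
    Submodule.mem_map_of_mem (cycles_le_conormalForms hρ k hα)

theorem ker_restrictCycles (hρ : ContMDiff (𝓡 1) 𝓘(ℝ, E →L[ℝ] E) ∞ ρ) (k : ℕ) :
    LinearMap.ker (restrictCycles (𝕜 := 𝕜) (V := V) hρ k) =
      (boundaries 𝕜 ρ hρ V k).submoduleOf (cycles 𝕜 ρ hρ V k) := by
  ext z
  constructor
  · intro hz
    have h : restrict 𝕜 ρ V k z = 0 := congrArg Subtype.val (LinearMap.mem_ker.1 hz)
    exact mem_boundaries hρ z.2 ((Submodule.Quotient.mk_eq_zero _).1 h)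
  · rintro ⟨η, hη⟩
    refine LinearMap.mem_ker.2 (Subtype.ext ?_)
    change restrict 𝕜 ρ V k z = 0
    have h := LinearMap.congr_fun (restrict_contractY (𝕜 := 𝕜) (V := V) hρ k) η
    change restrict 𝕜 ρ V k (contractY 𝕜 ρ hρ V k η) = 0 at h
    rwa [hη] at h

theorem restrictCycles_surjective (hρ : ContMDiff (𝓡 1) 𝓘(ℝ, E →L[ℝ] E) ∞ ρ) (k : ℕ) :
    Function.Surjective (restrictCycles (𝕜 := 𝕜) (V := V) hρ k) := by
  rintro ⟨_, α, hα, rfl⟩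
  obtain ⟨z, hz, e⟩ := exists_cycle hρ hα
  exact ⟨⟨z, hz⟩, Subtype.ext e⟩

/-- The homology of the relative forms is the space of horizontal forms on the loop space. -/
def homologyEquiv (hρ : ContMDiff (𝓡 1) 𝓘(ℝ, E →L[ℝ] E) ∞ ρ) (k : ℕ) :
    KoszulHomology 𝕜 ρ hρ V k ≃ₗ[𝕜] horizontalForms 𝕜 ρ V k :=
  (Submodule.quotEquivOfEq _ _ (ker_restrictCycles hρ k).symm).trans
    ((restrictCycles hρ k).quotKerEquivOfSurjective (restrictCycles_surjective hρ k))

end Restriction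

end CircleLoop

end

theorem mainTheorem4 (𝕜 : Type) [RCLike 𝕜] (m : ℕ)
    (ρ : Circle →* (EuclideanSpace ℂ (Fin m) →L[ℝ] EuclideanSpace ℂ (Fin m)))
    (hρ : ContMDiff (𝓡 1) 𝓘(ℝ, EuclideanSpace ℂ (Fin m) →L[ℝ] EuclideanSpace ℂ (Fin m)) ∞ ρ)
    (V : Opens (EuclideanSpace ℂ (Fin m))) (hV : ∀ g : Circle, ∀ v ∈ V, ρ g v ∈ V) :
    (∀ k : ℕ, CircleLoop.restrict 𝕜 ρ V k ∘ₗ CircleLoop.contractY 𝕜 ρ hρ V k = 0) ∧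
    (∀ k : ℕ, ∀ α ∈ CircleLoop.cycles 𝕜 ρ hρ V k,
      CircleLoop.restrict 𝕜 ρ V k α ∈ CircleLoop.horizontalForms 𝕜 ρ V k) ∧
    (∀ k : ℕ, ∃ e : CircleLoop.KoszulHomology 𝕜 ρ hρ V k ≃ₗ[𝕜]
        CircleLoop.horizontalForms 𝕜 ρ V k,
      ∀ z : CircleLoop.cycles 𝕜 ρ hρ V k,
        (e (Submodule.Quotient.mk z) : CircleLoop.LoopForm 𝕜 ρ V k) =
          CircleLoop.restrict 𝕜 ρ V k z) := by
  refine ⟨CircleLoop.restrict_contractY hρ, fun k α hα => ?_, fun k => ?_⟩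
  · exact Submodule.mem_map_of_mem (CircleLoop.cycles_le_conormalForms hρ k hα)
  -- The equivalence acts on representatives by `restrict`, so its value on a class is the
  -- restriction by definition.
  · exact ⟨CircleLoop.homologyEquiv hρ k, fun z => rfl⟩
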